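/- Let $\alpha\ge 1/2$, $\lambda>0$, $\tau\in(0,1)$. Let $\gamma_{\alpha,\lambda}(u)=\frac{\lambda^\alpha}{\Gamma(\alpha)}u^{\alpha-1}e^{-\lambda u}$, $u>0$, be the gamma density with shape $\alpha$ and rate $\lambda$ (shape $0$ means the Dirac mass at $0$), and let $X$ be a random variable with values in $(0,\infty)$ and Lebesgue density $f_X$. *Smart path.* $X_\tau$ has the law of $(1-\tau)\,\Gamma+\tau Y$, where, given $X=x$, $K$ is Poisson with parameter $x\lambda\tau/(1-\tau)$; given $K=k$, $Y$ is gamma with shape $k$ and rate $\lambda\tau/(1-\tau)$; and $\Gamma$ is gamma with shape $\alpha$ and rate $\lambda$, independent of $(X,K,Y)$. *Fisher information.* For a random variable $U$ on $(0,\infty)$ with differentiable density $f_U$ there, $J_{st,\gamma}(U)=\mathbb E\big[U\big((\log f_U)'(U)-\tfrac{\alpha-1}{U}+\lambda\big)^2\big]\in[0,\infty]$. *Stein kernel.* Assume that $X$ has a Stein kernel, that is, a function $\tau_X$ with $\mathbb E|\tau_X(X)|<\infty$ such that for all $\phi\in C_c^\infty((0,\infty))$ $$\mathbb E\big[(\lambda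 X-\alpha+\tfrac12)\phi(X)\big]=\mathbb E\big[\tau_X(X)\sqrt X\,(\sqrt{\cdot}\,\phi)'(X)\big].$$ *Semigroup.* Let $P_\tau$ be the Laguerre semigroup at time $-\log(\tau)/\lambda$, $P_\tau h(x)=\int_0^\infty h(u)p_\tau(x,u)\,du$ with $$p_\tau(x,u)=\tfrac{\lambda}{1-\tau}\Big(\tfrac{u}{\tau x}\Big)^{\frac{\alpha-1}2}e^{-\frac{\lambda u}{1-\tau}}e^{-\frac{\lambda\tau x}{1-\tau}}I_{\alpha-1}\Big(\tfrac{2\lambda\sqrt{ux\tau}}{1-\tau}\Big),$$ where $I_{\alpha-1}$ is the modified Bessel function of the first kind. Put $v_\tau=\log P_\tau(f_X/\gamma_{\alpha,\lambda})$ and $\partial^\sigma\phi(x)=\sqrt x\,\phi'(x)$. Let $Z$ be standard normal and $G$ gamma with shape $\alpha-\frac12$ and rate $\lambda$, with $X,Z,G$ independent, and set $$W=\sqrt\tau\sqrt X+\sqrt{\tfrac{1-\tau}{2\lambda}}\,Z,\qquad X_\tau=(1-\tau)G+W^2,\qquad \mathcal V(X_\tau)=\frac{W}{\sqrt{(1-\tau)G+W^2}}.$$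 Then this $X_\tau$ has the law of the smart path, $|\mathcal V(X_\tau)|\le 1$ almost surely, and $J_{st,\gamma}(X_\tau)<\infty$. The random variable $(\tau_X(X)-1)\,Z\,\mathcal V(X_\tau)\,\partial^\sigma(v_\tau)(X_\tau)$ is integrable whenever $\mathbb E[\sqrt X\,|\tau_X(X)|]<\infty$; and whenever it is integrable, $$J_{st,\gamma}(X_\tau)=\sqrt{\tfrac{\lambda}{2}}\,\frac{\tau}{\sqrt{1-\tau}}\;\mathbb E\big[(\tau_X(X)-1)\,Z\,\mathcal V(X_\tau)\,\partial^\sigma(v_\tau)(X_\tau)\big].$$ -/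

import Mathlib

open MeasureTheory ProbabilityTheory Set
open scoped ENNReal NNReal ContDiff

namespace LaguerreStein

noncomputable section

/-- The gamma law with shape `a` and rate `r`; for shape `0` it is the Dirac mass at `0`. -/
def gammaLaw (a r : ℝ) : Measure ℝ :=
  if a = 0 then Measure.dirac 0 else gammaMeasure a r

/-- The law of the gamma smart path `X_τ` started from a random variable `X` with law `μ`:
draw `x` from `μ`, then `k` from the Poisson law with parameter `x lam τ / (1 - τ)`, then
independently `G` from the gamma law `(α, lam)` and `Y` from the gamma law
`(k, lam τ / (1 - τ))` (`Y = 0` if `k = 0`), and return `(1 - τ) G + τ Y`. -/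
def smartPathLaw (α lam τ : ℝ) (μ : Measure ℝ) : Measure ℝ :=
  μ.bind fun x =>
    (poissonMeasure (Real.toNNReal (x * lam * τ / (1 - τ)))).bind fun k =>
      ((gammaLaw α lam).prod (gammaLaw (k : ℝ) (lam * τ / (1 - τ)))).map
        fun p : ℝ × ℝ => (1 - τ) * p.1 + τ * p.2

/-- `f` is a differentiable Lebesgue density of the law `ν` on `(0, ∞)`. Only the values of `f`
on `(0, ∞)` matter, and `ν` determines them. -/
structure IsDiffDensity (ν : Measure ℝ) (f : ℝ → ℝ) : Prop where
  nonneg : ∀ u, 0 < u → 0 ≤ f u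
  differentiableOn : DifferentiableOn ℝ f (Ioi 0)
  eq_withDensity : ν = (volume.restrict (Ioi 0)).withDensity fun u => ENNReal.ofReal (f u)

/-- The score `∂_u log f` of a density `f`. -/
def score (f : ℝ → ℝ) (u : ℝ) : ℝ := deriv (fun t => Real.log (f t)) u

/-- The score `(α - 1) / u - lam` of the gamma law. -/
def gammaScore (α lam u : ℝ) : ℝ := (α - 1) / u - lam

open Classical in
/-- The standardized Fisher information `E[Y (ρ_Y(Y) - ρ_{α, lam}(Y)) ^ 2]` of a random variable
`Y` with law `ν` on `(0, ∞)`, as an extended nonnegative number (`⊤` if `ν` has no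
differentiable density on `(0, ∞)`). -/
def fisherInfo (α lam : ℝ) (ν : Measure ℝ) : ℝ≥0∞ :=
  if h : ∃ f, IsDiffDensity ν f then
    ∫⁻ y, ENNReal.ofReal (y * (score h.choose y - gammaScore α lam y) ^ 2) ∂ν
  else ⊤

/-- The modified Bessel function of the first kind of order `ν`, at a positive argument. -/
def besselI (ν z : ℝ) : ℝ :=
  ∑' n : ℕ, (z / 2) ^ (2 * (n : ℝ) + ν) / ((n.factorial : ℝ) * Real.Gamma ((n : ℝ) + ν + 1))

/-- The transition density of the Laguerre semigroup with parameters `(α, lam)` at time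
`- log τ / lam`, from `x > 0` to `u > 0`. -/
def laguerreKernel (α lam τ x u : ℝ) : ℝ :=
  lam / (1 - τ) * (u / (τ * x)) ^ ((α - 1) / 2) * Real.exp (-(lam * u / (1 - τ))) *
    Real.exp (-(lam * τ * x / (1 - τ))) *
    besselI (α - 1) (2 * lam * Real.sqrt (u * x * τ) / (1 - τ))

/-- The Laguerre semigroup after the time change `t = - log τ / lam`. -/
def laguerreSemigroup (α lam τ : ℝ) (f : ℝ → ℝ) (x : ℝ) : ℝ :=
  ∫ u in Ioi (0 : ℝ), f u * laguerreKernel α lam τ x u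

/-- The operator `∂^σ φ (x) = √x φ'(x)`. -/
def dSigma (φ : ℝ → ℝ) (x : ℝ) : ℝ := Real.sqrt x * deriv φ x

/-- The dual operator `(∂^σ)^* φ (x) = d/dx (√x φ(x))`. -/
def dSigmaStar (φ : ℝ → ℝ) (x : ℝ) : ℝ := deriv (fun y => Real.sqrt y * φ y) x

/-- `T` is a Stein kernel, relative to the gamma law `(α, lam)`, of a random variable `X` with
law `μ` on `(0, ∞)`: `T(X)` is integrable and
`E[(lam X - α + 1/2) φ(X)] = E[T(X) √X (∂^σ)^* φ (X)]` for every smooth test function `φ` with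
compact support in `(0, ∞)`. -/
structure IsSteinKernel (α lam : ℝ) (μ : Measure ℝ) (T : ℝ → ℝ) : Prop where
  integrable : Integrable T μ
  stein : ∀ φ : ℝ → ℝ, ContDiff ℝ ∞ φ → HasCompactSupport φ → tsupport φ ⊆ Ioi 0 →
    ∫ x, (lam * x - α + 1 / 2) * φ x ∂μ = ∫ x, T x * (Real.sqrt x * dSigmaStar φ x) ∂μ

/-- `v_τ = log P_τ (f / γ_{α, lam})`. -/
def logRatio (α lam τ : ℝ) (f : ℝ → ℝ) (u : ℝ) : ℝ :=
  Real.log (laguerreSemigroup α lam τ (fun y => f y / gammaPDFReal α lam y) u)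

/-- The Gaussian factor `√τ √x + √((1 - τ) / (2 lam)) z`. -/
def shiftedGaussian (lam τ x z : ℝ) : ℝ :=
  Real.sqrt τ * Real.sqrt x + Real.sqrt ((1 - τ) / (2 * lam)) * z

/-- `(1 - τ) g + (√τ √x + √((1 - τ) / (2 lam)) z) ^ 2`; evaluated at independent `x = X`,
`z = Z` standard normal, and `g` of gamma law `(α - 1/2, lam)`, it represents `X_τ`. -/
def pathPoint (lam τ x z g : ℝ) : ℝ := (1 - τ) * g + shiftedGaussian lam τ x z ^ 2

/-- The ratio `𝒱`. -/
def ratioV (lam τ x z g : ℝ) : ℝ :=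
  shiftedGaussian lam τ x z / Real.sqrt (pathPoint lam τ x z g)

/-- `(T(x) - 1) z 𝒱 ∂^σ(v_τ)`, where `𝒱` and `∂^σ(v_τ)` are taken at the point of the path
given by `x`, `z` and `g`. -/
def steinIntegrand (α lam τ : ℝ) (f T : ℝ → ℝ) (x z g : ℝ) : ℝ :=
  (T x - 1) * z * ratioV lam τ x z g * dSigma (logRatio α lam τ f) (pathPoint lam τ x z g)

end

end LaguerreStein

open LaguerreStein

/-! Put `r = lam / (1 - τ)`, `F = ₀F₁(; α; ·)`, and let `γ` be the gamma law `(α, r)`. Given `X =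
x`, the Poisson mixture of gamma laws and the variable `(1 - τ) G + W²` have the same Laplace
transform, that of a noncentral gamma law, whose density relative to `γ` is `e^{-rτx} F(r²τux)`. So
both constructions of `X_τ` have the density `N(u) = E[e^{-rτX} F(r²τuX)]` (`relDensity`) relative
to `γ`. The Laguerre kernel divided by the gamma density is the same expression up to a factor
`const * e^{-rτu}`. Hence `∂^σ v_τ` equals `ρ(u) = √u (N'/N - rτ)` (`relScore`), and the Fisher
information is `E[ρ(X_τ)²]`.

For the representation formula, fix `X = x` and write `W = s (Z + b)` with `b = √(2rτx)`, `s = √((1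
- τ) / (2 lam))`. The integrand becomes `(T(x) - 1) s k(X_τ) Z (Z + b)` with `k = ρ / √u`. A
Gaussian shift turns `E[k(X_τ) Z (Z + b)]` into `e^{-b²/2} (M''(b) - b M'(b))`, where `M(t) = ∫ k(u)
F(r t² u / 2) dγ(u)`; the differential equation of `F` eliminates `F''`
(`integral_gaussian_weight`). For fixed `u` the resulting kernel in `x` is, up to a factor depending
on `u`, equal to `2 (φ / 2 + x φ')` with `φ(x) = e^{-rτx} F'(r²τux)`, which is the form of the right
side of the Stein identity. That identity, with `lam + rτ = r`, evaluates the integral in `x` as `2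
/ (rτ) * (N' - rτ N)` (`integral_stein_kernel`), and integrating in `u` reassembles `ρ²` against the
law of `X_τ`.

Three analytic points remain. The function `φ` is not compactly supported, so the Stein identity is
extended by cutoffs; the same cutoffs show that a Stein kernel forces `E X < ∞`. The score satisfies
`|ρ(u)| ≤ C (1 + √u)`, by `√y F'(y) ≤ F(y)`, which uses `α ≥ 1/2`; this yields finiteness of the
information and integrability. Finally, Fubini is applied with the path restricted to `[1/m, m]`,
and `m → ∞` by dominated convergence. -/

namespace LaguerreStein

/-! ### The function `₀F₁`: growth, smoothness, differential equation -/

/-- The coefficients of the confluent hypergeometric limit function `₀F₁(; a; ·)`. -/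
noncomputable def hypCoef (a : ℝ) (n : ℕ) : ℝ :=
  Real.Gamma a / (n.factorial * Real.Gamma (a + n))

/-- The confluent hypergeometric limit function `₀F₁(; a; y)`. -/
noncomputable def hypF (a y : ℝ) : ℝ := ∑' n : ℕ, hypCoef a n * y ^ n

lemma hypCoef_pos {a : ℝ} (ha : 0 < a) (n : ℕ) : 0 < hypCoef a n := by
  have h1 := Real.Gamma_pos_of_pos ha
  have h2 := Real.Gamma_pos_of_pos (show 0 < a + n by positivity)
  unfold hypCoef
  positivity

lemma hypCoef_zero {a : ℝ} (ha : 0 < a) : hypCoef a 0 = 1 := by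
  have h1 := Real.Gamma_pos_of_pos ha
  simp [hypCoef, h1.ne']

lemma hypCoef_succ {a : ℝ} (ha : 0 < a) (n : ℕ) :
    hypCoef a (n + 1) * ((n + 1) * (a + n)) = hypCoef a n := by
  have h3 : 0 < a + n := by positivity
  have h2 := Real.Gamma_pos_of_pos h3
  have h4 : Real.Gamma (a + (n + 1 : ℕ)) = (a + n) * Real.Gamma (a + n) := by
    rw [← Real.Gamma_add_one h3.ne']; push_cast; ring_nf
  unfold hypCoef
  rw [h4, Nat.factorial_succ]
  push_cast
  field_simp

lemma hypCoef_add_one {a : ℝ} (ha : 0 < a) (n : ℕ) :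
    hypCoef (a + 1) n / a = (n + 1) * hypCoef a (n + 1) := by
  have h3 : 0 < a + (n + 1 : ℕ) := by positivity
  have h2 := Real.Gamma_pos_of_pos h3
  unfold hypCoef
  rw [Real.Gamma_add_one ha.ne', Nat.factorial_succ,
    show a + 1 + (n : ℝ) = a + (n + 1 : ℕ) by push_cast; ring]
  push_cast at h2 ⊢
  field_simp

/-- The coefficients decrease in `a`, and at `a = 1/2` the bound is an equality, since `₀F₁(; 1/2;
y) = cosh (2√y)`. In the induction, `a` is replaced by `1/2` in the recursion factor `a + n`. -/
lemma hypCoef_le {a : ℝ} (ha : 1 / 2 ≤ a) (n : ℕ) :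
    hypCoef a n ≤ 4 ^ n / ((2 * n).factorial : ℝ) := by
  have ha0 : 0 < a := by linarith
  induction n with
  | zero => simp [hypCoef_zero ha0]
  | succ n ih =>
    have h1 := hypCoef_succ ha0 n
    have h2 := hypCoef_pos ha0 (n + 1)
    have hn : (0 : ℝ) ≤ n := by positivity
    have h3 : hypCoef a (n + 1) * ((n + 1) * (1 / 2 + n)) ≤ 4 ^ n / ((2 * n).factorial : ℝ) := by
      refine le_trans ?_ ih
      rw [← h1]
      gcongr
    rw [show 2 * (n + 1) = 2 * n + 1 + 1 by ring, Nat.factorial_succ, Nat.factorial_succ]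
    push_cast
    rw [le_div_iff₀ (by positivity)] at h3 ⊢
    rw [pow_succ]
    linarith

lemma four_pow_mul_pow_eq {y : ℝ} (hy : 0 ≤ y) (n : ℕ) :
    4 ^ n / ((2 * n).factorial : ℝ) * y ^ n = (2 * √y) ^ (2 * n) / (2 * n).factorial := by
  rw [pow_mul, mul_pow, Real.sq_sqrt hy, mul_pow]
  norm_num
  ring

lemma hypCoef_mul_pow_le {a : ℝ} (ha : 1 / 2 ≤ a) {y : ℝ} (hy : 0 ≤ y) (n : ℕ) :
    hypCoef a n * y ^ n ≤ (2 * √y) ^ (2 * n) / (2 * n).factorial := by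
  rw [← four_pow_mul_pow_eq hy]
  gcongr
  exact hypCoef_le ha n

lemma summable_hyp {a : ℝ} (ha : 1 / 2 ≤ a) (y : ℝ) :
    Summable fun n => hypCoef a n * y ^ n := by
  refine Summable.of_norm ?_
  refine Summable.of_nonneg_of_le (fun _ => norm_nonneg _) (fun n => ?_)
    (Real.hasSum_cosh (2 * √|y|)).summable
  rw [norm_mul, norm_pow, Real.norm_eq_abs, Real.norm_eq_abs,
    abs_of_pos (hypCoef_pos (by linarith) n)]
  exact hypCoef_mul_pow_le ha (abs_nonneg y) n

lemma hasSum_hypF {a : ℝ} (ha : 1 / 2 ≤ a) (y : ℝ) :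
    HasSum (fun n => hypCoef a n * y ^ n) (hypF a y) := (summable_hyp ha y).hasSum

lemma one_le_hypF {a : ℝ} (ha : 1 / 2 ≤ a) {y : ℝ} (hy : 0 ≤ y) : 1 ≤ hypF a y := by
  have ha0 : 0 < a := by linarith
  have := (summable_hyp ha y).le_tsum 0
    (fun n _ => mul_nonneg (hypCoef_pos ha0 n).le (pow_nonneg hy n))
  rwa [hypCoef_zero ha0, pow_zero, mul_one] at this

lemma hypF_pos {a : ℝ} (ha : 1 / 2 ≤ a) {y : ℝ} (hy : 0 ≤ y) : 0 < hypF a y :=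
  lt_of_lt_of_le one_pos (one_le_hypF ha hy)

lemma hypF_le_exp {a : ℝ} (ha : 1 / 2 ≤ a) {y : ℝ} (hy : 0 ≤ y) :
    hypF a y ≤ Real.exp (2 * √y) := by
  have h1 : hypF a y ≤ Real.cosh (2 * √y) :=
    hasSum_le (fun n => hypCoef_mul_pow_le ha hy n) (hasSum_hypF ha y) (Real.hasSum_cosh _)
  refine h1.trans ?_
  rw [Real.cosh_eq]
  have : Real.exp (-(2 * √y)) ≤ Real.exp (2 * √y) := by
    apply Real.exp_le_exp.2; nlinarith [Real.sqrt_nonneg y]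
  linarith

lemma hypF_mono {a : ℝ} (ha : 1 / 2 ≤ a) {y z : ℝ} (hy : 0 ≤ y) (hyz : y ≤ z) :
    hypF a y ≤ hypF a z := by
  refine hasSum_le (fun n => ?_) (hasSum_hypF ha y) (hasSum_hypF ha z)
  have := (hypCoef_pos (show 0 < a by linarith) n).le
  gcongr

lemma summable_hyp_deriv {a : ℝ} (ha : 1 / 2 ≤ a) (y : ℝ) :
    Summable fun n : ℕ => hypCoef a n * (n * y ^ (n - 1)) := by
  rw [← summable_nat_add_iff 1]
  refine ((summable_hyp (show 1 / 2 ≤ a + 1 by linarith) y).div_const a).congr fun n => ?_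
  rw [mul_div_right_comm, hypCoef_add_one (by linarith), Nat.add_sub_cancel]
  push_cast
  ring

lemma tsum_hyp_deriv {a : ℝ} (ha : 1 / 2 ≤ a) (y : ℝ) :
    ∑' n : ℕ, hypCoef a n * (n * y ^ (n - 1)) = hypF (a + 1) y / a := by
  rw [(summable_hyp_deriv ha y).tsum_eq_zero_add, hypF, ← tsum_div_const]
  simp only [Nat.cast_zero, zero_mul, mul_zero, zero_add]
  congr with n
  rw [mul_div_right_comm, hypCoef_add_one (by linarith), Nat.add_sub_cancel]
  push_cast
  ring

lemma hasDerivAt_hypF {a : ℝ} (ha : 1 / 2 ≤ a) (y : ℝ) :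
    HasDerivAt (hypF a) (hypF (a + 1) y / a) y := by
  have ha0 : 0 < a := by linarith
  have hy : y ∈ Metric.ball (0 : ℝ) (|y| + 1) := by simp
  have h0 : (0 : ℝ) ∈ Metric.ball (0 : ℝ) (|y| + 1) := by
    rw [mem_ball_zero_iff, norm_zero]; positivity
  rw [← tsum_hyp_deriv ha y]
  refine hasDerivAt_tsum_of_isPreconnected (g := fun n y => hypCoef a n * y ^ n)
    (g' := fun n y => hypCoef a n * (n * y ^ (n - 1)))
    (summable_hyp_deriv ha (|y| + 1)) Metric.isOpen_ball
    (convex_ball (0 : ℝ) _).isPreconnected (fun n z _ => (hasDerivAt_pow n z).const_mul _) ?_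
    h0 (summable_hyp ha 0) hy
  intro n z hz
  rw [mem_ball_zero_iff, Real.norm_eq_abs] at hz
  have := (hypCoef_pos ha0 n).le
  rw [norm_mul, norm_mul, norm_pow, Real.norm_of_nonneg this, Real.norm_natCast,
    Real.norm_eq_abs]
  gcongr

/-- The derivative is a multiple of the same function with parameter `a + 1`, so the induction runs
over all parameters at once. -/
lemma contDiff_hypF {a : ℝ} (ha : 1 / 2 ≤ a) : ContDiff ℝ ∞ (hypF a) := by
  rw [contDiff_infty]
  intro n
  induction n generalizing a with
  | zero =>
    exact contDiff_zero.2 (continuous_iff_continuousAt.2 fun y => (hasDerivAt_hypF ha y).continuousAt)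
  | succ n ih =>
    have : ((n + 1 : ℕ) : WithTop ℕ∞) = (n : WithTop ℕ∞) + 1 := by norm_cast
    rw [this, contDiff_succ_iff_deriv]
    refine ⟨fun y => (hasDerivAt_hypF ha y).differentiableAt, by simp, ?_⟩
    have hd : deriv (hypF a) = fun y => hypF (a + 1) y / a :=
      funext fun y => (hasDerivAt_hypF ha y).deriv
    rw [hd]
    exact (ih (by linarith)).div_const a

lemma continuous_hypF {a : ℝ} (ha : 1 / 2 ≤ a) : Continuous (hypF a) :=
  (contDiff_hypF ha).continuous

/-- The differential equation of `₀F₁`, as a contiguity relation. -/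
lemma hypF_ode {a : ℝ} (ha : 1 / 2 ≤ a) (y : ℝ) :
    hypF a y = hypF (a + 1) y + y * (hypF (a + 2) y / (a * (a + 1))) := by
  have ha0 : 0 < a := by linarith
  have ha1 : 1 / 2 ≤ a + 1 := by linarith
  have ha2 : 1 / 2 ≤ a + 2 := by linarith
  rw [hypF, (summable_hyp ha y).tsum_eq_zero_add, hypF, (summable_hyp ha1 y).tsum_eq_zero_add,
    hypCoef_zero ha0, hypCoef_zero (by linarith), add_assoc, hypF, ← tsum_div_const,
    ← tsum_mul_left, ← Summable.tsum_add]
  · congr with n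
    have e1 := hypCoef_add_one ha0 (n + 1)
    have e2 := hypCoef_add_one (show 0 < a + 1 by linarith) n
    have e3 := hypCoef_succ ha0 (n + 1)
    rw [show a + 1 + 1 = a + 2 by ring, div_eq_iff (by linarith)] at e2
    rw [div_eq_iff ha0.ne'] at e1
    rw [← e3, e2, e1]
    push_cast
    field_simp
    ring
  · exact (summable_nat_add_iff 1).2 (summable_hyp ha1 y)
  · exact ((summable_hyp ha2 y).div_const _).mul_left _

/-- `√y F'(y) ≤ F(y)`. -/
lemma sqrt_mul_deriv_hypF_le {a : ℝ} (ha : 1 / 2 ≤ a) {y : ℝ} (hy : 0 ≤ y) :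
    √y * (hypF (a + 1) y / a) ≤ hypF a y := by
  have ha0 : 0 < a := by linarith
  have ha1 : 1 / 2 ≤ a + 1 := by linarith
  -- `D = F² - y F'²`. The equation `y F'' + a F' = F` reduces its derivative to `(2a - 1) F'²`,
  -- which is nonnegative exactly because `a ≥ 1/2`. Then `D(y) ≥ D(0) ≥ 0`.
  set D : ℝ → ℝ := fun y => hypF a y ^ 2 - y * (hypF (a + 1) y / a) ^ 2
  have hD : ∀ y, HasDerivAt D ((2 * a - 1) * (hypF (a + 1) y / a) ^ 2) y := by
    intro y
    have h1 := (hasDerivAt_hypF ha y).pow 2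
    have h2 := (hasDerivAt_id y).mul (((hasDerivAt_hypF ha1 y).div_const a).pow 2)
    refine (h1.sub h2).congr_deriv ?_
    have e := hypF_ode ha y
    rw [show a + 1 + 1 = a + 2 by ring]
    simp only [id, Pi.pow_apply, Nat.cast_ofNat, Nat.add_one_sub_one, pow_one, one_mul]
    rw [e]
    field_simp
    ring
  have hm : Monotone D := by
    refine monotone_of_deriv_nonneg (fun y => (hD y).differentiableAt) fun y => ?_
    rw [(hD y).deriv]
    have : 0 ≤ 2 * a - 1 := by linarith
    positivity
  have h0 : 0 ≤ D y := by
    refine le_trans ?_ (hm hy)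
    simp only [D, zero_mul, sub_zero]
    positivity
  refine abs_le_of_sq_le_sq' ?_ (hypF_pos ha hy).le |>.2
  rw [mul_pow, Real.sq_sqrt hy]
  simpa [D] using h0

/-! ### Exponential moments and the laws they determine -/

lemma integrable_exp_of_lintegral {μ : Measure ℝ} {t : ℝ}
    (h : ∫⁻ u, ENNReal.ofReal (Real.exp (t * u)) ∂μ ≠ ⊤) :
    Integrable (fun u => Real.exp (t * u)) μ := by
  refine ⟨by fun_prop, ?_⟩
  rw [hasFiniteIntegral_iff_ofReal (ae_of_all _ fun u => (Real.exp_pos _).le)]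
  exact h.lt_top

/-- Finite measures on the line with the same finite exponential moments of all orders `t < r`,
`0 < r`, are equal. -/
lemma measure_ext_of_lintegral_exp {μ ν : Measure ℝ} [IsFiniteMeasure μ] [IsFiniteMeasure ν]
    {r : ℝ} (hr : 0 < r)
    (h : ∀ t < r, ∫⁻ u, ENNReal.ofReal (Real.exp (t * u)) ∂μ =
      ∫⁻ u, ENNReal.ofReal (Real.exp (t * u)) ∂ν)
    (hfin : ∀ t < r, ∫⁻ u, ENNReal.ofReal (Real.exp (t * u)) ∂μ ≠ ⊤) : μ = ν := by
  have hsub (κ : Measure ℝ)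
      (hκ : ∀ t < r, ∫⁻ u, ENNReal.ofReal (Real.exp (t * u)) ∂κ ≠ ⊤) :
      Iio r ⊆ interior (integrableExpSet id κ) :=
    interior_maximal (fun t ht => integrable_exp_of_lintegral (hκ t ht)) isOpen_Iio
  have hμ := hsub μ hfin
  have hν := hsub ν fun t ht => h t ht ▸ hfin t ht
  have hmgf : ∀ t < r, mgf id μ t = mgf id ν t := by
    intro t ht
    simp only [mgf, id]
    rw [integral_eq_lintegral_of_nonneg_ae (ae_of_all _ fun u => (Real.exp_pos _).le)
      (by fun_prop), integral_eq_lintegral_of_nonneg_ae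
      (ae_of_all _ fun u => (Real.exp_pos _).le) (by fun_prop), h t ht]
  -- Both complex moment generating functions are analytic on the half-plane `Re z < r`, which
  -- contains the imaginary axis because `0 < r`. They agree at real points accumulating at `0`,
  -- hence throughout, and on the imaginary axis they are the characteristic functions.
  have hEq : EqOn (complexMGF id μ) (complexMGF id ν) {z | z.re < r} := by
    refine AnalyticOnNhd.eqOn_of_preconnected_of_frequently_eq
      (analyticOnNhd_complexMGF.mono fun z hz => hμ hz)
      (analyticOnNhd_complexMGF.mono fun z hz => hν hz)
      ((convex_Iio r).linear_preimage Complex.reLm).isPreconnected (z₀ := 0) (by simpa) ?_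
    have h0 : ∀ᶠ t : ℝ in nhdsWithin 0 {0}ᶜ, complexMGF id μ t = complexMGF id ν t := by
      filter_upwards [nhdsWithin_le_nhds (Iio_mem_nhds hr)] with t ht
      rw [complexMGF_ofReal, complexMGF_ofReal, hmgf t ht]
    have ht : Filter.Tendsto (fun t : ℝ => (t : ℂ)) (nhdsWithin 0 {0}ᶜ) (nhdsWithin 0 {0}ᶜ) := by
      refine tendsto_nhdsWithin_iff.2 ⟨?_, ?_⟩
      · exact (Complex.continuous_ofReal.tendsto' 0 0 (by simp)).mono_left nhdsWithin_le_nhds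
      · filter_upwards [self_mem_nhdsWithin] with t ht
        simpa using ht
    exact ht.frequently h0.frequently
  refine Measure.ext_of_charFun (funext fun t => ?_)
  rw [← complexMGF_id_mul_I, ← complexMGF_id_mul_I]
  exact hEq (by simpa using hr)

lemma lintegral_exp_gammaMeasure {a r t : ℝ} (ha : 0 < a) (hr : 0 < r) (ht : t < r) :
    ∫⁻ u, ENNReal.ofReal (Real.exp (t * u)) ∂gammaMeasure a r =
      ENNReal.ofReal ((r / (r - t)) ^ a) := by
  have hrt : 0 < r - t := sub_pos.2 ht
  rw [gammaMeasure, lintegral_withDensity_eq_lintegral_mul _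
    (by unfold gammaPDF; fun_prop) (by fun_prop)]
  have : ∀ u, (gammaPDF a r * fun u => ENNReal.ofReal (Real.exp (t * u))) u =
      ENNReal.ofReal ((r / (r - t)) ^ a) * gammaPDF a (r - t) u := by
    intro u
    rw [Pi.mul_apply, gammaPDF, gammaPDF, ← ENNReal.ofReal_mul (gammaPDFReal_nonneg ha hr u),
      ← ENNReal.ofReal_mul (by positivity)]
    congr 1
    unfold gammaPDFReal
    split_ifs with hu
    · rw [Real.div_rpow hr.le hrt.le, show -((r - t) * u) = -(r * u) + t * u by ring, Real.exp_add]
      have := Real.rpow_pos_of_pos hrt a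
      field_simp
    · simp
  simp_rw [this]
  rw [lintegral_const_mul _ (by unfold gammaPDF; fun_prop), lintegral_gammaPDF_eq_one ha hrt,
    mul_one]

lemma lintegral_exp_gammaLaw {a r t : ℝ} (ha : 0 ≤ a) (hr : 0 < r) (ht : t < r) :
    ∫⁻ u, ENNReal.ofReal (Real.exp (t * u)) ∂gammaLaw a r =
      ENNReal.ofReal ((r / (r - t)) ^ a) := by
  unfold gammaLaw
  split_ifs with h
  · rw [lintegral_dirac' _ (by fun_prop)]
    simp [h]
  · exact lintegral_exp_gammaMeasure (lt_of_le_of_ne ha (Ne.symm h)) hr ht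

lemma isProbabilityMeasure_gammaLaw {a r : ℝ} (ha : 0 ≤ a) (hr : 0 < r) :
    IsProbabilityMeasure (gammaLaw a r) := by
  unfold gammaLaw
  split_ifs with h
  · infer_instance
  · exact isProbabilityMeasure_gammaMeasure (lt_of_le_of_ne ha (Ne.symm h)) hr

lemma gammaLaw_ae_nonneg (a r : ℝ) : ∀ᵐ u ∂gammaLaw a r, 0 ≤ u := by
  unfold gammaLaw
  split_ifs with h
  · rw [ae_dirac_iff measurableSet_Ici]
  · rw [gammaMeasure, ae_withDensity_iff (by unfold gammaPDF; fun_prop)]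
    refine ae_of_all _ fun u hu => ?_
    by_contra h
    exact hu (gammaPDF_of_neg (not_le.1 h))

/-! ### The noncentral gamma law and its two constructions -/

/-- The density of the noncentral gamma law, the mixture of the gamma laws `(a + k, r)` where `k`
has the Poisson law of parameter `θ`. -/
noncomputable def ncGammaPDF (a r θ u : ℝ) : ℝ :=
  gammaPDFReal a r u * (Real.exp (-θ) * hypF a (r * θ * u))

/-- The noncentral gamma law. -/
noncomputable def ncGamma (a r θ : ℝ) : Measure ℝ :=
  (volume.restrict (Ioi 0)).withDensity fun u => ENNReal.ofReal (ncGammaPDF a r θ u)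

lemma ncGammaPDF_nonneg {a r θ u : ℝ} (ha : 1 / 2 ≤ a) (hr : 0 < r) (hθ : 0 ≤ θ) (hu : 0 < u) :
    0 ≤ ncGammaPDF a r θ u := by
  have := hypF_pos ha (show 0 ≤ r * θ * u by positivity)
  have := gammaPDFReal_nonneg (show 0 < a by linarith) hr u
  unfold ncGammaPDF
  positivity

lemma measurable_ncGammaPDF {a : ℝ} (ha : 1 / 2 ≤ a) (r θ : ℝ) :
    Measurable (ncGammaPDF a r θ) := by
  have := (continuous_hypF ha).measurable
  unfold ncGammaPDF
  fun_prop

/-- Each term of the power series of `₀F₁`, multiplied by the gamma density, is a gamma density with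
shape raised by `n`. This is what makes the noncentral gamma density a Poisson mixture. -/
lemma gammaPDFReal_mul_hypCoef {a r u : ℝ} (ha : 0 < a) (hr : 0 < r) (hu : 0 < u) (n : ℕ) :
    gammaPDFReal a r u * (hypCoef a n * (r * u) ^ n) = gammaPDFReal (a + n) r u / n.factorial := by
  have h1 := Real.Gamma_pos_of_pos ha
  have h2 := Real.Gamma_pos_of_pos (show 0 < a + n by positivity)
  simp only [gammaPDFReal, if_pos hu.le, hypCoef]
  rw [show a + n - 1 = (a - 1) + n by ring, Real.rpow_add_natCast hr.ne',
    Real.rpow_add_natCast hu.ne', mul_pow]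
  field_simp

lemma ofReal_ncGammaPDF {a r θ u : ℝ} (ha : 1 / 2 ≤ a) (hr : 0 < r) (hθ : 0 ≤ θ) (hu : 0 < u) :
    ENNReal.ofReal (ncGammaPDF a r θ u) =
      ∑' n : ℕ, ENNReal.ofReal (Real.exp (-θ) * θ ^ n / n.factorial) * gammaPDF (a + n) r u := by
  have ha0 : 0 < a := by linarith
  have hs : HasSum (fun n : ℕ => Real.exp (-θ) * θ ^ n / n.factorial * gammaPDFReal (a + n) r u)
      (ncGammaPDF a r θ u) := by
    refine (((hasSum_hypF ha (r * θ * u)).mul_left (Real.exp (-θ))).mul_left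
      (gammaPDFReal a r u)).congr_fun fun n => ?_
    rw [mul_div_assoc, mul_assoc, div_mul_eq_mul_div, mul_div_assoc,
      ← gammaPDFReal_mul_hypCoef ha0 hr hu n, mul_pow, mul_pow, mul_pow]
    ring
  rw [← hs.tsum_eq, ENNReal.ofReal_tsum_of_nonneg _ hs.summable]
  · congr with n
    rw [ENNReal.ofReal_mul (by positivity), gammaPDF]
  · intro n
    have := gammaPDFReal_nonneg (show 0 < a + n by positivity) hr u
    positivity

lemma gammaMeasure_eq_restrict (a r : ℝ) :
    gammaMeasure a r = (volume.restrict (Ioi 0)).withDensity (gammaPDF a r) := by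
  have hm : Measurable (gammaPDF a r) := by unfold gammaPDF; fun_prop
  rw [gammaMeasure, ← withDensity_indicator measurableSet_Ioi]
  refine withDensity_congr_ae ?_
  have : ∀ᵐ u : ℝ, u ≠ 0 := by simp [ae_iff]
  filter_upwards [this] with u hu
  by_cases h : u ∈ Ioi (0 : ℝ)
  · rw [indicator_of_mem h]
  · rw [indicator_of_notMem h, gammaPDF_of_neg (lt_of_le_of_ne (not_lt.1 h) hu)]

lemma tsum_poisson_mul_pow {θ c : ℝ} (hθ : 0 ≤ θ) (hc : 0 ≤ c) :
    ∑' n : ℕ, ENNReal.ofReal (Real.exp (-θ) * θ ^ n / n.factorial) * ENNReal.ofReal (c ^ n) =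
      ENNReal.ofReal (Real.exp (θ * (c - 1))) := by
  have hs : HasSum (fun n : ℕ => Real.exp (-θ) * θ ^ n / n.factorial * c ^ n)
      (Real.exp (θ * (c - 1))) := by
    have h := (NormedSpace.expSeries_div_hasSum_exp (θ * c)).mul_left (Real.exp (-θ))
    rw [← Real.exp_eq_exp_ℝ, ← Real.exp_add, show -θ + θ * c = θ * (c - 1) by ring] at h
    refine h.congr_fun fun n => ?_
    rw [mul_pow]; ring
  rw [← hs.tsum_eq, ENNReal.ofReal_tsum_of_nonneg (fun n => by positivity) hs.summable]
  congr with n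
  rw [ENNReal.ofReal_mul (by positivity)]

lemma lintegral_exp_ncGamma {a r θ t : ℝ} (ha : 1 / 2 ≤ a) (hr : 0 < r) (hθ : 0 ≤ θ)
    (ht : t < r) :
    ∫⁻ u, ENNReal.ofReal (Real.exp (t * u)) ∂ncGamma a r θ =
      ENNReal.ofReal ((r / (r - t)) ^ a * Real.exp (θ * (r / (r - t) - 1))) := by
  have ha0 : 0 < a := by linarith
  have hrt : 0 < r - t := sub_pos.2 ht
  have hm := measurable_ncGammaPDF ha r θ
  rw [ncGamma, lintegral_withDensity_eq_lintegral_mul _ (by fun_prop) (by fun_prop)]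
  have h1 : ∀ u ∈ Ioi (0 : ℝ), ((fun u => ENNReal.ofReal (ncGammaPDF a r θ u)) *
      fun u => ENNReal.ofReal (Real.exp (t * u))) u =
      ∑' n : ℕ, ENNReal.ofReal (Real.exp (-θ) * θ ^ n / n.factorial) *
        (gammaPDF (a + n) r * fun u => ENNReal.ofReal (Real.exp (t * u))) u := by
    intro u hu
    rw [Pi.mul_apply, ofReal_ncGammaPDF ha hr hθ hu, ← ENNReal.tsum_mul_right]
    simp_rw [Pi.mul_apply, mul_assoc]
  have hg : ∀ n : ℕ, Measurable (gammaPDF (a + n) r) := fun n => by unfold gammaPDF; fun_prop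
  rw [setLIntegral_congr_fun measurableSet_Ioi h1, lintegral_tsum]
  · have h2 : ∀ n : ℕ, ∫⁻ u in Ioi (0 : ℝ), ENNReal.ofReal (Real.exp (-θ) * θ ^ n / n.factorial) *
        (gammaPDF (a + n) r * fun u => ENNReal.ofReal (Real.exp (t * u))) u =
        ENNReal.ofReal ((r / (r - t)) ^ a) *
        (ENNReal.ofReal (Real.exp (-θ) * θ ^ n / n.factorial) *
          ENNReal.ofReal ((r / (r - t)) ^ n)) := by
      intro n
      rw [lintegral_const_mul _ ((hg n).mul (by fun_prop)),
        ← lintegral_withDensity_eq_lintegral_mul _ (hg n) (by fun_prop),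
        ← gammaMeasure_eq_restrict, lintegral_exp_gammaMeasure (by positivity) hr ht,
        Real.rpow_add_natCast (by positivity), ENNReal.ofReal_mul (by positivity)]
      ring
    simp_rw [h2]
    rw [ENNReal.tsum_mul_left, tsum_poisson_mul_pow hθ (by positivity),
      ENNReal.ofReal_mul (by positivity)]
  · intro n
    exact (((hg n).mul (by fun_prop)).const_mul _).aemeasurable

lemma isProbabilityMeasure_ncGamma {a r θ : ℝ} (ha : 1 / 2 ≤ a) (hr : 0 < r) (hθ : 0 ≤ θ) :
    IsProbabilityMeasure (ncGamma a r θ) := by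
  constructor
  have := lintegral_exp_ncGamma ha hr hθ hr
  simpa [hr.ne'] using this

lemma lintegral_exp_map_add {μ ν : Measure ℝ} [SFinite μ] [SFinite ν] {g h : ℝ → ℝ}
    (hg : Measurable g) (hh : Measurable h) (t : ℝ) :
    ∫⁻ u, ENNReal.ofReal (Real.exp (t * u)) ∂((μ.prod ν).map fun p : ℝ × ℝ => g p.1 + h p.2) =
      (∫⁻ u, ENNReal.ofReal (Real.exp (t * g u)) ∂μ) *
        ∫⁻ u, ENNReal.ofReal (Real.exp (t * h u)) ∂ν := by
  rw [lintegral_map (by fun_prop) (by fun_prop), ← lintegral_prod_mul (by fun_prop) (by fun_prop)]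
  refine lintegral_congr fun p => ?_
  rw [mul_add, Real.exp_add, ENNReal.ofReal_mul (Real.exp_pos _).le]

/-- Completing the square: the tilted Gaussian density is a constant times the Gaussian density of
mean `b (c - 1)` and variance `c = r / (r - t)`. The factor `c ^ (1/2)` is that of a gamma law of
shape `1/2`, and the exponential is that of a noncentrality `b² / 2`. -/
lemma lintegral_exp_sq_gaussian {r t : ℝ} (hr : 0 < r) (ht : t < r) (b : ℝ) :
    ∫⁻ z, ENNReal.ofReal (Real.exp (t * ((z + b) ^ 2 / (2 * r)))) ∂gaussianReal 0 1 =
      ENNReal.ofReal ((r / (r - t)) ^ (1 / 2 : ℝ) * Real.exp (b ^ 2 / 2 * (r / (r - t) - 1))) := by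
  have hrt : 0 < r - t := sub_pos.2 ht
  set c := r / (r - t) with hc
  have hc0 : 0 < c := by positivity
  rw [gaussianReal_of_var_ne_zero _ one_ne_zero, lintegral_withDensity_eq_lintegral_mul _
    (by fun_prop) (by fun_prop)]
  have : ∀ z, (gaussianPDF 0 1 * fun z => ENNReal.ofReal (Real.exp (t * ((z + b) ^ 2 / (2 * r))))) z
      = ENNReal.ofReal (c ^ (1 / 2 : ℝ) * Real.exp (b ^ 2 / 2 * (c - 1))) *
        gaussianPDF (b * (c - 1)) c.toNNReal z := by
    intro z
    rw [Pi.mul_apply, gaussianPDF, gaussianPDF, ← ENNReal.ofReal_mul (gaussianPDFReal_nonneg _ _ _),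
      ← ENNReal.ofReal_mul (by positivity)]
    congr 1
    rw [gaussianPDFReal, gaussianPDFReal, Real.coe_toNNReal _ hc0.le,
      ← Real.sqrt_eq_rpow]
    have h1 : 0 < √c := Real.sqrt_pos.2 hc0
    have h2 : t = r * (c - 1) / c := by rw [hc]; field_simp; ring
    have h3 : Real.exp (-(z - 0) ^ 2 / 2) * Real.exp (t * ((z + b) ^ 2 / (2 * r))) =
        Real.exp (b ^ 2 / 2 * (c - 1)) * Real.exp (-(z - b * (c - 1)) ^ 2 / (2 * c)) := by
      rw [← Real.exp_add, ← Real.exp_add, h2]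
      congr 1
      field_simp
      ring
    rw [NNReal.coe_one, mul_one, mul_one, mul_assoc, h3, Real.sqrt_mul (show 0 ≤ 2 * Real.pi by positivity) c]
    field_simp
  simp_rw [this]
  rw [lintegral_const_mul _ (by fun_prop), lintegral_gaussianPDF_eq_one _ (by simpa), mul_one]

/-- `(1 - τ) G + W²` has a noncentral gamma law if `W` is Gaussian of variance `1 / (2 r)`. -/
lemma map_gaussian_gamma_eq_ncGamma {α r q : ℝ} (hα : 1 / 2 ≤ α) (hr : 0 < r) (hq : 0 < q)
    (b : ℝ) :
    ((gaussianReal 0 1).prod (gammaLaw (α - 1 / 2) (r * q))).map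
      (fun p : ℝ × ℝ => (p.1 + b) ^ 2 / (2 * r) + q * p.2) = ncGamma α r (b ^ 2 / 2) := by
  have hα' : 0 ≤ α - 1 / 2 := by linarith
  have := isProbabilityMeasure_gammaLaw hα' (mul_pos hr hq)
  have := isProbabilityMeasure_ncGamma hα hr (show 0 ≤ b ^ 2 / 2 by positivity)
  have := Measure.isProbabilityMeasure_map (μ := (gaussianReal 0 1).prod
    (gammaLaw (α - 1 / 2) (r * q))) (f := fun p : ℝ × ℝ => (p.1 + b) ^ 2 / (2 * r) + q * p.2)
    (by fun_prop)
  have key : ∀ t < r, ∫⁻ u, ENNReal.ofReal (Real.exp (t * u)) ∂(((gaussianReal 0 1).prod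
      (gammaLaw (α - 1 / 2) (r * q))).map
      (fun p : ℝ × ℝ => (p.1 + b) ^ 2 / (2 * r) + q * p.2)) =
      ENNReal.ofReal ((r / (r - t)) ^ α * Real.exp (b ^ 2 / 2 * (r / (r - t) - 1))) := by
    intro t ht
    have hrt : 0 < r - t := sub_pos.2 ht
    rw [lintegral_exp_map_add (g := fun z => (z + b) ^ 2 / (2 * r)) (h := fun g => q * g)
      (by fun_prop) (by fun_prop), lintegral_exp_sq_gaussian hr ht]
    simp_rw [← mul_assoc]
    rw [lintegral_exp_gammaLaw hα' (mul_pos hr hq) (by nlinarith),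
      ← ENNReal.ofReal_mul (by positivity),
      show r * q / (r * q - t * q) = r / (r - t) by rw [← sub_mul, mul_div_mul_right _ _ hq.ne']]
    congr 1
    -- The Gaussian square contributes shape `1/2` and `G` contributes `α - 1/2`, for a total of
    -- `α`.
    rw [mul_right_comm, ← Real.rpow_add (by positivity)]
    congr 2
    ring
  refine measure_ext_of_lintegral_exp hr (fun t ht => ?_) fun t ht => ?_
  · rw [key t ht, lintegral_exp_ncGamma hα hr (by positivity) ht]
  · rw [key t ht]; exact ENNReal.ofReal_ne_top

/-- The Poisson mixture of gamma laws in the smart path is a noncentral gamma law. -/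
lemma poisson_bind_gamma_eq_ncGamma {α lam τ θ : ℝ} (hα : 1 / 2 ≤ α) (hlam : 0 < lam)
    (hτ0 : 0 < τ) (hτ1 : τ < 1) (hθ : 0 ≤ θ) :
    ((poissonMeasure (Real.toNNReal θ)).bind fun k =>
      ((gammaLaw α lam).prod (gammaLaw (k : ℝ) (lam * τ / (1 - τ)))).map
        fun p : ℝ × ℝ => (1 - τ) * p.1 + τ * p.2) = ncGamma α (lam / (1 - τ)) θ := by
  have h1τ : 0 < 1 - τ := sub_pos.2 hτ1
  -- After scaling, `(1 - τ) Γ` and `τ Y` both have rate `r`, so their shapes add to `α + k`.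
  set r := lam / (1 - τ) with hr'
  have hr : 0 < r := by positivity
  have hlr : lam = r * (1 - τ) := by rw [hr']; field_simp
  have e : lam * τ / (1 - τ) = r * τ := by rw [hr']; ring
  have hrτ : 0 < r * τ := by positivity
  rw [e]
  have := isProbabilityMeasure_gammaLaw (show 0 ≤ α by linarith) hlam
  have hk : ∀ k : ℕ, IsProbabilityMeasure (gammaLaw (k : ℝ) (r * τ)) := fun k =>
    isProbabilityMeasure_gammaLaw (by positivity) hrτ
  have hkm : ∀ k : ℕ, IsProbabilityMeasure (((gammaLaw α lam).prod (gammaLaw (k : ℝ) (r * τ))).map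
        fun p : ℝ × ℝ => (1 - τ) * p.1 + τ * p.2) := fun k =>
    Measure.isProbabilityMeasure_map (by fun_prop)
  have := isProbabilityMeasure_ncGamma hα hr hθ
  set F : ℕ → Measure ℝ := fun k => ((gammaLaw α lam).prod (gammaLaw (k : ℝ) (r * τ))).map
        fun p : ℝ × ℝ => (1 - τ) * p.1 + τ * p.2 with hF
  have hFm : Measurable F := measurable_from_top
  have key : ∀ t < r, ∫⁻ u, ENNReal.ofReal (Real.exp (t * u))
      ∂((poissonMeasure (Real.toNNReal θ)).bind F) =
      ENNReal.ofReal ((r / (r - t)) ^ α * Real.exp (θ * (r / (r - t) - 1))) := by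
    intro t ht
    have hrt : 0 < r - t := sub_pos.2 ht
    rw [Measure.lintegral_bind hFm.aemeasurable (by fun_prop)]
    have hin : ∀ k : ℕ, ∫⁻ u, ENNReal.ofReal (Real.exp (t * u)) ∂(F k) =
        ENNReal.ofReal ((r / (r - t)) ^ α) * ENNReal.ofReal ((r / (r - t)) ^ k) := by
      intro k
      rw [hF]
      dsimp only
      rw [lintegral_exp_map_add (g := fun z => (1 - τ) * z) (h := fun g => τ * g)
        (by fun_prop) (by fun_prop)]
      simp_rw [← mul_assoc]
      rw [lintegral_exp_gammaLaw (by linarith) hlam (by nlinarith),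
        lintegral_exp_gammaLaw (by positivity) hrτ (by nlinarith), Real.rpow_natCast,
        show r * τ / (r * τ - t * τ) = r / (r - t) by rw [← sub_mul, mul_div_mul_right _ _ hτ0.ne']]
      congr 3
      rw [hlr, ← sub_mul, mul_div_mul_right _ _ h1τ.ne']
    simp_rw [hin]
    rw [lintegral_const_mul _ (by fun_prop), poissonMeasure, lintegral_sum_measure]
    simp_rw [lintegral_smul_measure, lintegral_dirac, smul_eq_mul]
    rw [Real.coe_toNNReal _ hθ, tsum_poisson_mul_pow hθ (by positivity),
      ENNReal.ofReal_mul (by positivity)]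
  have : IsFiniteMeasure ((poissonMeasure (Real.toNNReal θ)).bind F) := by
    constructor
    rw [Measure.bind_apply MeasurableSet.univ hFm.aemeasurable]
    simp [F]
  refine measure_ext_of_lintegral_exp hr (fun t ht => ?_) fun t ht => ?_
  · rw [key t ht, lintegral_exp_ncGamma hα hr (by positivity) ht]
  · rw [key t ht]; exact ENNReal.ofReal_ne_top

/-! ### Differentiating integrals of `₀F₁` in a parameter -/

lemma le_two_mul_exp_sqrt {x : ℝ} (hx : 0 ≤ x) : x ≤ 2 * Real.exp √x := by
  have h1 := Real.quadratic_le_exp_of_nonneg (Real.sqrt_nonneg x)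
  have h2 := Real.sq_sqrt hx
  have := Real.sqrt_nonneg x
  linarith

/-- A weight `w` on `(0, ∞)` all of whose moments `∫ w(x) exp(C √x)` exist. -/
def HasSqrtExpMoments (ρ : Measure ℝ) (w : ℝ → ℝ) : Prop :=
  ∀ C : ℝ, Integrable (fun x => w x * Real.exp (C * √x)) ρ

lemma HasSqrtExpMoments.integrable {ρ : Measure ℝ} {w : ℝ → ℝ} (h : HasSqrtExpMoments ρ w) :
    Integrable w ρ := by
  simpa using h 0

lemma HasSqrtExpMoments.mul_of_abs_le {ρ : Measure ℝ} {w g : ℝ → ℝ} (h : HasSqrtExpMoments ρ w)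
    (hg : AEStronglyMeasurable g ρ) {A B : ℝ}
    (hb : ∀ᵐ x ∂ρ, |g x| ≤ A * Real.exp (B * √x)) :
    HasSqrtExpMoments ρ (fun x => w x * g x) := by
  intro C
  refine ((h (B + C)).norm.const_mul A).mono'
    ((h.integrable.aestronglyMeasurable.mul hg).mul (by fun_prop)) ?_
  filter_upwards [hb] with x hx
  rw [norm_mul, norm_mul, norm_mul, Real.norm_of_nonneg (Real.exp_pos _).le,
    Real.norm_of_nonneg (Real.exp_pos _).le, add_mul, Real.exp_add, Real.norm_eq_abs (g x)]
  calc ‖w x‖ * |g x| * Real.exp (C * √x)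
      ≤ ‖w x‖ * (A * Real.exp (B * √x)) * Real.exp (C * √x) := by gcongr
    _ = _ := by ring

lemma HasSqrtExpMoments.mul_id {ρ : Measure ℝ} {w : ℝ → ℝ} (h : HasSqrtExpMoments ρ w)
    (hρ : ∀ᵐ x ∂ρ, 0 ≤ x) : HasSqrtExpMoments ρ (fun x => w x * x) := by
  refine h.mul_of_abs_le (by fun_prop) (A := 2) (B := 1) ?_
  filter_upwards [hρ] with x hx
  rw [abs_of_nonneg hx, one_mul]
  exact le_two_mul_exp_sqrt hx

/-- Since `₀F₁` grows at most like `exp (2 √(y x))`, the class of weights is stable under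
multiplication by it. Together with stability under multiplication by `x`, this lets the
differentiation below be repeated. -/
lemma HasSqrtExpMoments.mul_hypF {ρ : Measure ℝ} {w : ℝ → ℝ} (h : HasSqrtExpMoments ρ w)
    (hρ : ∀ᵐ x ∂ρ, 0 ≤ x) {a y : ℝ} (ha : 1 / 2 ≤ a) (hy : 0 ≤ y) :
    HasSqrtExpMoments ρ (fun x => w x * hypF a (y * x)) := by
  have hc := continuous_hypF ha
  refine h.mul_of_abs_le (by fun_prop) (A := 1) (B := 2 * √y) ?_
  filter_upwards [hρ] with x hx
  rw [abs_of_pos (hypF_pos ha (by positivity)), one_mul, mul_assoc, ← Real.sqrt_mul hy]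
  exact hypF_le_exp ha (by positivity)

/-- Differentiation under the integral sign. On the neighbourhood `(0, 2y)` the derivative is
dominated by its value at `2y`, because `₀F₁` increases on the half-line. -/
lemma hasDerivAt_integral_hypF {ρ : Measure ℝ} {w : ℝ → ℝ} (h : HasSqrtExpMoments ρ w)
    (hρ : ∀ᵐ x ∂ρ, 0 ≤ x) {a y : ℝ} (ha : 1 / 2 ≤ a) (hy : 0 < y) :
    HasDerivAt (fun y => ∫ x, w x * hypF a (y * x) ∂ρ)
      ((∫ x, w x * x * hypF (a + 1) (y * x) ∂ρ) / a) y := by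
  have ha0 : 0 < a := by linarith
  have ha1 : 1 / 2 ≤ a + 1 := by linarith
  have hc := continuous_hypF ha
  have hc1 := continuous_hypF ha1
  have hwm := h.integrable.aestronglyMeasurable
  have key := hasDerivAt_integral_of_dominated_loc_of_deriv_le (μ := ρ) (x₀ := y)
    (F := fun y x => w x * hypF a (y * x))
    (F' := fun y x => w x * x * hypF (a + 1) (y * x) / a)
    (bound := fun x => ‖w x * x * hypF (a + 1) ((2 * y) * x) / a‖)
    (s := Ioo 0 (2 * y)) (Ioo_mem_nhds hy (by linarith))
    (Filter.Eventually.of_forall fun z => hwm.mul (by fun_prop))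
    (h.mul_hypF hρ ha hy.le).integrable
    (((hwm.mul (by fun_prop)).mul (by fun_prop)).mul aestronglyMeasurable_const) ?_
    ((((h.mul_id hρ).mul_hypF hρ ha1 (by positivity)).integrable.div_const a).norm) ?_
  · rw [← integral_div]
    exact key.2
  · filter_upwards [hρ] with x hx z hz
    rw [norm_div, norm_div, norm_mul, norm_mul _ (hypF (a + 1) (2 * y * x))]
    have h1 : hypF (a + 1) (z * x) ≤ hypF (a + 1) (2 * y * x) :=
      hypF_mono ha1 (mul_nonneg hz.1.le hx) (mul_le_mul_of_nonneg_right hz.2.le hx)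
    have h2 := hypF_pos ha1 (mul_nonneg hz.1.le hx)
    rw [Real.norm_of_nonneg h2.le, Real.norm_of_nonneg (h2.le.trans h1)]
    gcongr
  · refine ae_of_all _ fun x z _ => ?_
    have h1 := ((hasDerivAt_hypF ha (z * x)).comp z ((hasDerivAt_id z).mul_const x)).const_mul (w x)
    refine h1.congr_deriv ?_
    ring

lemma gammaMeasure_ae_nonneg {a : ℝ} (ha : 0 < a) (r : ℝ) : ∀ᵐ u ∂gammaMeasure a r, 0 ≤ u := by
  have := gammaLaw_ae_nonneg a r
  rwa [gammaLaw, if_neg ha.ne'] at this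

lemma hasSqrtExpMoments_gamma {a r : ℝ} (ha : 0 < a) (hr : 0 < r) :
    HasSqrtExpMoments (gammaMeasure a r) (fun _ => 1) := by
  intro C
  have h1 : Integrable (fun u => Real.exp (r / 2 * u)) (gammaMeasure a r) := by
    refine integrable_exp_of_lintegral ?_
    rw [lintegral_exp_gammaMeasure ha hr (by linarith)]
    exact ENNReal.ofReal_ne_top
  have hpos : ∀ᵐ u ∂gammaMeasure a r, 0 ≤ u := by
    have := gammaLaw_ae_nonneg a r
    rwa [gammaLaw, if_neg ha.ne'] at this
  refine (h1.const_mul (Real.exp (C ^ 2 / (2 * r)))).mono' (by fun_prop) ?_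
  filter_upwards [hpos] with u hu
  rw [one_mul, Real.norm_of_nonneg (Real.exp_pos _).le, ← Real.exp_add, Real.exp_le_exp]
  have h2 := Real.sq_sqrt hu
  have h3 : C ^ 2 / (2 * r) + r / 2 * u - C * √u = (C - r * √u) ^ 2 / (2 * r) := by
    rw [sub_sq, mul_pow, h2]; field_simp; ring
  have h4 : 0 ≤ (C - r * √u) ^ 2 / (2 * r) := by positivity
  linarith

/-! ### Gaussian shift and the weight `Z (Z + b)` -/

lemma gaussianReal_eq_withDensity (b : ℝ) :
    gaussianReal b 1 = (gaussianReal 0 1).withDensity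
      fun z => ENNReal.ofReal (Real.exp (b * z - b ^ 2 / 2)) := by
  rw [gaussianReal_of_var_ne_zero _ one_ne_zero, gaussianReal_of_var_ne_zero _ one_ne_zero,
    ← withDensity_mul _ (by fun_prop) (by fun_prop)]
  congr with z
  rw [Pi.mul_apply, gaussianPDF, gaussianPDF, ← ENNReal.ofReal_mul (gaussianPDFReal_nonneg _ _ _)]
  congr 1
  rw [gaussianPDFReal, gaussianPDFReal, mul_assoc _ (Real.exp _), ← Real.exp_add]
  congr 2
  rw [NNReal.coe_one]
  ring

/-- Translation of a Gaussian variable as a change of density. -/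
lemma integral_gaussian_prod_shift (ν : Measure ℝ) [SFinite ν] (b : ℝ) {Φ : ℝ × ℝ → ℝ}
    (hΦ : Measurable Φ) :
    ∫ p, Φ (p.1 + b, p.2) ∂(gaussianReal 0 1).prod ν =
      Real.exp (-(b ^ 2 / 2)) * ∫ p, Φ p * Real.exp (b * p.1) ∂(gaussianReal 0 1).prod ν := by
  have h1 : ((gaussianReal 0 1).prod ν).map (fun p => (p.1 + b, p.2)) = (gaussianReal b 1).prod ν := by
    have := Measure.map_prod_map (gaussianReal 0 1) ν (f := fun z => z + b) (g := id)
      (by fun_prop) measurable_id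
    rw [Measure.map_id, gaussianReal_map_add_const, zero_add] at this
    rw [this]
    rfl
  rw [← integral_map (φ := fun p : ℝ × ℝ => (p.1 + b, p.2)) (f := Φ) (by fun_prop)
    hΦ.aestronglyMeasurable, h1, gaussianReal_eq_withDensity, prod_withDensity_left (by fun_prop),
    integral_withDensity_eq_integral_toReal_smul (by fun_prop) (by simp), ← integral_const_mul]
  congr with p
  rw [ENNReal.toReal_ofReal (Real.exp_pos _).le, smul_eq_mul, sub_eq_add_neg, Real.exp_add]
  ring

lemma integral_ncGamma {a r θ : ℝ} (ha : 1 / 2 ≤ a) (hr : 0 < r) (hθ : 0 ≤ θ) (k : ℝ → ℝ) :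
    ∫ u, k u ∂ncGamma a r θ =
      Real.exp (-θ) * ∫ u, k u * hypF a (r * θ * u) ∂gammaMeasure a r := by
  have hm := measurable_ncGammaPDF ha r θ
  rw [ncGamma, gammaMeasure_eq_restrict,
    integral_withDensity_eq_integral_toReal_smul (by fun_prop) (by simp),
    integral_withDensity_eq_integral_toReal_smul (by unfold gammaPDF; fun_prop)
      (by simp [gammaPDF]), ← integral_const_mul]
  refine setIntegral_congr_fun measurableSet_Ioi fun u hu => ?_
  rw [gammaPDF, ENNReal.toReal_ofReal (ncGammaPDF_nonneg ha hr hθ hu),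
    ENNReal.toReal_ofReal (gammaPDFReal_nonneg (by linarith) hr u), ncGammaPDF, smul_eq_mul,
    smul_eq_mul]
  ring

/-- After the shift the left side is `e^{-b²/2} (M''(b) - b M'(b))` with `M(t) = E[k(S) exp(t Z)]`,
`S` being the unshifted point. The same shift without the weight, with the noncentral gamma law of
the shifted point, gives `M(t) = ∫ k(u) F(r t² u / 2) dγ(u)`, which can be differentiated
explicitly. Nonnegativity of `k` lets `k(S)` be a density, so that `M` is the moment generating
function of `Z` under a measure. -/
lemma integral_gaussian_weight_of_nonneg {α r q : ℝ} (hα : 1 / 2 ≤ α) (hr : 0 < r) (hq : 0 < q)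
    {b : ℝ} (hb : 0 < b) {k : ℝ → ℝ} (hk : Measurable k) {C : ℝ} (hk0 : ∀ u, 0 ≤ k u)
    (hkC : ∀ u, k u ≤ C) :
    ∫ p : ℝ × ℝ, k ((p.1 + b) ^ 2 / (2 * r) + q * p.2) * (p.1 * (p.1 + b))
        ∂(gaussianReal 0 1).prod (gammaLaw (α - 1 / 2) (r * q)) =
      Real.exp (-(b ^ 2 / 2)) * ∫ u, k u * (r * u * (2 * hypF α (r * (b ^ 2 / 2) * u) +
        (1 - 2 * α - b ^ 2) * (hypF (α + 1) (r * (b ^ 2 / 2) * u) / α))) ∂gammaMeasure α r := by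
  have hα0 : 0 < α := by linarith
  have hα1 : 1 / 2 ≤ α + 1 := by linarith
  have hpos := gammaMeasure_ae_nonneg hα0 r
  have hprob := isProbabilityMeasure_gammaLaw (show 0 ≤ α - 1 / 2 by linarith) (mul_pos hr hq)
  set μ0 := (gaussianReal 0 1).prod (gammaLaw (α - 1 / 2) (r * q)) with hμ0
  set S : ℝ × ℝ → ℝ := fun p => p.1 ^ 2 / (2 * r) + q * p.2 with hS
  have hSm : Measurable S := by fun_prop
  have hkS : Measurable fun p => k (S p) := hk.comp hSm
  set ρ := μ0.withDensity fun p => ENNReal.ofReal (k (S p)) with hρ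
  have hρi : ∀ Φ : ℝ × ℝ → ℝ, ∫ p, Φ p ∂ρ = ∫ p, k (S p) * Φ p ∂μ0 := by
    intro Φ
    rw [hρ, integral_withDensity_eq_integral_toReal_smul (by fun_prop) (by simp)]
    simp_rw [ENNReal.toReal_ofReal (hk0 _), smul_eq_mul]
  have hexp : ∀ t : ℝ, Integrable (fun p : ℝ × ℝ => Real.exp (t * p.1)) ρ := by
    intro t
    have h1 : Integrable (fun p : ℝ × ℝ => Real.exp (t * p.1)) μ0 :=
      (integrable_exp_mul_gaussianReal t).comp_fst _
    have hle : ρ ≤ ENNReal.ofReal C • μ0 := by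
      rw [← withDensity_const]
      exact withDensity_mono (ae_of_all _ fun p => ENNReal.ofReal_le_ofReal (hkC _))
    exact (h1.smul_measure ENNReal.ofReal_ne_top).mono_measure hle
  have hint : interior (integrableExpSet (Prod.fst : ℝ × ℝ → ℝ) ρ) = univ := by
    rw [(eq_univ_iff_forall.2 hexp : integrableExpSet (Prod.fst : ℝ × ℝ → ℝ) ρ = univ), interior_univ]
  have hD (t : ℝ) (n : ℕ) := hasDerivAt_integral_pow_mul_exp_real (X := (Prod.fst : ℝ × ℝ → ℝ))
    (μ := ρ) (t := t) (hint ▸ mem_univ t) n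
  have hw : HasSqrtExpMoments (gammaMeasure α r) k := by
    have := (hasSqrtExpMoments_gamma hα0 hr).mul_of_abs_le (g := k) hk.aestronglyMeasurable
      (A := C) (B := 0) (ae_of_all _ fun u => by simpa [abs_of_nonneg (hk0 u)] using hkC u)
    simpa using this
  have hw1 := hw.mul_id hpos
  set Q : ℝ → ℝ := fun y => ∫ u, k u * hypF α (y * u) ∂gammaMeasure α r with hQ
  set Q1 : ℝ → ℝ := fun y => (∫ u, k u * u * hypF (α + 1) (y * u) ∂gammaMeasure α r) / α with hQ1
  set Q2 : ℝ → ℝ := fun y => (∫ u, k u * u * u * hypF (α + 1 + 1) (y * u) ∂gammaMeasure α r) /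
    (α + 1) / α with hQ2
  have hQd : ∀ y, 0 < y → HasDerivAt Q (Q1 y) y := fun y hy => hasDerivAt_integral_hypF hw hpos hα hy
  have hQ1d : ∀ y, 0 < y → HasDerivAt Q1 (Q2 y) y := fun y hy =>
    (hasDerivAt_integral_hypF hw1 hpos hα1 hy).div_const α
  -- Two evaluations of `E[k]` at the point shifted by `t`: by change of density, and by the
  -- noncentral gamma law with noncentrality `t² / 2`. The factor `e^{-t²/2}` appears in both and
  -- cancels.
  have hM0 : ∀ t, ∫ p : ℝ × ℝ, p.1 ^ 0 * Real.exp (t * p.1) ∂ρ = Q (r * (t ^ 2 / 2)) := by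
    intro t
    have h1 := integral_gaussian_prod_shift (gammaLaw (α - 1 / 2) (r * q)) t hkS
    have h2 := integral_map (μ := μ0) (φ := fun p : ℝ × ℝ => (p.1 + t) ^ 2 / (2 * r) + q * p.2)
      (f := k) (by fun_prop) hk.aestronglyMeasurable
    rw [map_gaussian_gamma_eq_ncGamma hα hr hq t, integral_ncGamma hα hr (by positivity)] at h2
    have h3 : Real.exp (-(t ^ 2 / 2)) ≠ 0 := (Real.exp_pos _).ne'
    simp_rw [pow_zero, one_mul]
    rw [hρi]
    refine mul_left_cancel₀ h3 (h1.symm.trans h2.symm)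
  have hy : ∀ t, HasDerivAt (fun t : ℝ => r * (t ^ 2 / 2)) (r * t) t := by
    intro t
    refine (((hasDerivAt_pow 2 t).div_const 2).const_mul r).congr_deriv ?_
    simp
  have hM1 : ∀ t, 0 < t →
      ∫ p : ℝ × ℝ, p.1 ^ (0 + 1) * Real.exp (t * p.1) ∂ρ = Q1 (r * (t ^ 2 / 2)) * (r * t) := by
    intro t ht
    have h1 := hD t 0
    simp_rw [hM0] at h1
    exact h1.unique ((hQd _ (by positivity)).comp t (hy t))
  have hM2 : ∫ p : ℝ × ℝ, p.1 ^ (0 + 1 + 1) * Real.exp (b * p.1) ∂ρ =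
      Q2 (r * (b ^ 2 / 2)) * (r * b) * (r * b) + Q1 (r * (b ^ 2 / 2)) * r := by
    have h1 := hD b (0 + 1)
    have h2 : HasDerivAt (fun t => Q1 (r * (t ^ 2 / 2)) * (r * t))
        (Q2 (r * (b ^ 2 / 2)) * (r * b) * (r * b) + Q1 (r * (b ^ 2 / 2)) * r) b := by
      have h4 := ((hQ1d _ (by positivity : 0 < r * (b ^ 2 / 2))).comp b (hy b)).mul
        ((hasDerivAt_id b).const_mul r)
      refine h4.congr_deriv ?_
      simp
    -- The formula for `M'` is known only for `t > 0`, where the argument `r t² / 2` of `Q` is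
    -- positive; as `b > 0`, that covers a neighbourhood of `b`.
    refine h1.unique (h2.congr_of_eventuallyEq ?_)
    filter_upwards [lt_mem_nhds hb] with t ht using hM1 t ht
  have hI : ∀ n : ℕ, Integrable (fun p : ℝ × ℝ => p.1 ^ n * Real.exp (b * p.1)) ρ := fun n =>
    integrable_pow_mul_exp_of_mem_interior_integrableExpSet (hint ▸ mem_univ b) n
  have hshift := integral_gaussian_prod_shift (gammaLaw (α - 1 / 2) (r * q)) b
    (Φ := fun p => k (S p) * ((p.1 - b) * p.1)) (by fun_prop)
  simp only [add_sub_cancel_right] at hshift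
  rw [hshift]
  congr 1
  have e1 : ∫ p, k (S p) * ((p.1 - b) * p.1) * Real.exp (b * p.1) ∂μ0 =
      ∫ p : ℝ × ℝ, p.1 ^ (0 + 1 + 1) * Real.exp (b * p.1) ∂ρ -
        b * ∫ p : ℝ × ℝ, p.1 ^ (0 + 1) * Real.exp (b * p.1) ∂ρ := by
    rw [← integral_const_mul, ← integral_sub (hI _) ((hI _).const_mul b), hρi]
    congr with p
    ring
  rw [e1, hM2, hM1 b hb]
  set y := r * (b ^ 2 / 2) with hydef
  have hy0 : 0 < y := by positivity
  have hi1 := (hw1.mul_hypF hpos hα1 hy0.le).integrable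
  have hi2 := ((hw1.mul_id hpos).mul_hypF hpos (show 1 / 2 ≤ α + 1 + 1 by linarith) hy0.le).integrable
  have e2 : Q2 y * (r * b) * (r * b) + Q1 y * r - b * (Q1 y * (r * b)) =
      (r * b) ^ 2 / (α + 1) / α * ∫ u, k u * u * u * hypF (α + 1 + 1) (y * u) ∂gammaMeasure α r +
      (r - b ^ 2 * r) / α * ∫ u, k u * u * hypF (α + 1) (y * u) ∂gammaMeasure α r := by
    simp only [hQ1, hQ2]; ring
  rw [e2, ← integral_const_mul, ← integral_const_mul,
    ← integral_add (hi2.const_mul _) (hi1.const_mul _)]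
  congr with u
  -- Since `(r b)² = 2 r y`, the second-order term is `2 r u * (y u) F''(y u)`, and the differential
  -- equation replaces `(y u) F''` by `F - α F'`.
  have e3 := hypF_ode hα (y * u)
  rw [show α + 1 + 1 = α + 2 by ring, e3, hydef]
  field_simp
  ring

/-- The expectation of `k(S) Z (Z + b)` for `S = (Z + b)² / (2 r) + q G`, in terms of `₀F₁`. -/
lemma integral_gaussian_weight {α r q : ℝ} (hα : 1 / 2 ≤ α) (hr : 0 < r) (hq : 0 < q)
    {b : ℝ} (hb : 0 < b) {k : ℝ → ℝ} (hk : Measurable k) {C : ℝ} (hkC : ∀ u, |k u| ≤ C) :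
    ∫ p : ℝ × ℝ, k ((p.1 + b) ^ 2 / (2 * r) + q * p.2) * (p.1 * (p.1 + b))
        ∂(gaussianReal 0 1).prod (gammaLaw (α - 1 / 2) (r * q)) =
      Real.exp (-(b ^ 2 / 2)) * ∫ u, k u * (r * u * (2 * hypF α (r * (b ^ 2 / 2) * u) +
        (1 - 2 * α - b ^ 2) * (hypF (α + 1) (r * (b ^ 2 / 2) * u) / α))) ∂gammaMeasure α r := by
  have hα0 : 0 < α := by linarith
  have hα1 : 1 / 2 ≤ α + 1 := by linarith
  have hC : 0 ≤ C := (abs_nonneg _).trans (hkC 0)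
  have hpos := gammaMeasure_ae_nonneg hα0 r
  have hprob := isProbabilityMeasure_gammaLaw (show 0 ≤ α - 1 / 2 by linarith) (mul_pos hr hq)
  -- Both sides are linear in `k`, so the signed case is the difference of the nonnegative cases `k
  -- + C` and `C`.
  have h1 := integral_gaussian_weight_of_nonneg hα hr hq hb (k := fun u => k u + C) (C := C + C)
    (by fun_prop) (fun u => by linarith [neg_le_of_abs_le (hkC u)])
    (fun u => by linarith [le_of_abs_le (hkC u)])
  have h2 := integral_gaussian_weight_of_nonneg hα hr hq hb (k := fun _ => C) (C := C)
    measurable_const (fun _ => hC) (fun _ => le_rfl)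
  have hZ : Integrable (fun p : ℝ × ℝ => p.1 * (p.1 + b))
      ((gaussianReal 0 1).prod (gammaLaw (α - 1 / 2) (r * q))) := by
    have i1 : Integrable (fun z : ℝ => z) (gaussianReal 0 1) :=
      (memLp_id_gaussianReal' 1 ENNReal.one_ne_top).integrable le_rfl
    have i2 : Integrable (fun z : ℝ => z ^ 2) (gaussianReal 0 1) :=
      (memLp_id_gaussianReal' 2 ENNReal.ofNat_ne_top).integrable_sq
    have i3 : Integrable (fun z : ℝ => z * (z + b)) (gaussianReal 0 1) :=
      (i2.add (i1.mul_const b)).congr (ae_of_all _ fun z => by simp only [Pi.add_apply]; ring)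
    exact i3.comp_fst _
  have hZk : Integrable (fun p : ℝ × ℝ => k ((p.1 + b) ^ 2 / (2 * r) + q * p.2) * (p.1 * (p.1 + b)))
      ((gaussianReal 0 1).prod (gammaLaw (α - 1 / 2) (r * q))) :=
    hZ.bdd_mul (c := C) (Measurable.aestronglyMeasurable (by fun_prop)) (ae_of_all _ fun p => hkC _)
  set y := r * (b ^ 2 / 2) with hy
  have hy0 : 0 ≤ y := by positivity
  have hR : Integrable (fun u => r * u * (2 * hypF α (y * u) +
      (1 - 2 * α - b ^ 2) * (hypF (α + 1) (y * u) / α))) (gammaMeasure α r) := by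
    have hw := (hasSqrtExpMoments_gamma hα0 hr).mul_id hpos
    have i1 := ((hw.mul_hypF hpos hα hy0).integrable.const_mul (r * 2))
    have i2 := ((hw.mul_hypF hpos hα1 hy0).integrable.const_mul (r * (1 - 2 * α - b ^ 2) / α))
    exact (i1.add i2).congr (ae_of_all _ fun u => by simp only [Pi.add_apply]; ring)
  have hRk : Integrable (fun u => k u * (r * u * (2 * hypF α (y * u) +
      (1 - 2 * α - b ^ 2) * (hypF (α + 1) (y * u) / α)))) (gammaMeasure α r) :=
    hR.bdd_mul (c := C) hk.aestronglyMeasurable (ae_of_all _ fun p => hkC _)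
  simp only [add_mul _ C] at h1
  rw [integral_add hZk (hZ.const_mul C), integral_add hRk (hR.const_mul C), h2] at h1
  linarith

/-! ### Cutoffs and the extension of the Stein identity -/

open Filter Topology

lemma deriv_smoothTransition_of_neg {x : ℝ} (hx : x < 0) : deriv Real.smoothTransition x = 0 := by
  have : Real.smoothTransition =ᶠ[𝓝 x] fun _ => 0 := by
    filter_upwards [Iio_mem_nhds hx] with y hy using Real.smoothTransition.zero_of_nonpos hy.le
  rw [this.deriv_eq, deriv_const]

lemma deriv_smoothTransition_of_one_lt {x : ℝ} (hx : 1 < x) :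
    deriv Real.smoothTransition x = 0 := by
  have : Real.smoothTransition =ᶠ[𝓝 x] fun _ => 1 := by
    filter_upwards [Ioi_mem_nhds hx] with y hy using Real.smoothTransition.one_of_one_le hy.le
  rw [this.deriv_eq, deriv_const]

lemma exists_abs_deriv_smoothTransition_le :
    ∃ K, 0 ≤ K ∧ ∀ x, |deriv Real.smoothTransition x| ≤ K := by
  have hc : Continuous (deriv Real.smoothTransition) :=
    (Real.smoothTransition.contDiff (n := 1)).continuous_deriv le_rfl
  obtain ⟨K, hK⟩ := (isCompact_Icc (a := (0 : ℝ)) (b := 1)).exists_bound_of_continuousOn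
    hc.continuousOn
  refine ⟨max K 0, le_max_right _ _, fun x => ?_⟩
  rcases lt_or_ge x 0 with h | h
  · simp [deriv_smoothTransition_of_neg h]
  rcases lt_or_ge 1 x with h' | h'
  · simp [deriv_smoothTransition_of_one_lt h']
  · exact (hK x ⟨h, h'⟩).trans (le_max_left _ _)

/-- A smooth function with support in `[1 / m, 2 m]`, equal to `1` on `[2 / m, m]`. -/
noncomputable def cutoff (m x : ℝ) : ℝ :=
  Real.smoothTransition (m * x - 1) * Real.smoothTransition (2 - x / m)

lemma contDiff_cutoff (m : ℝ) : ContDiff ℝ ∞ (cutoff m) := by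
  refine ContDiff.mul (Real.smoothTransition.contDiff.comp ?_)
    (Real.smoothTransition.contDiff.comp ?_) <;> fun_prop

lemma cutoff_nonneg (m x : ℝ) : 0 ≤ cutoff m x :=
  mul_nonneg (Real.smoothTransition.nonneg _) (Real.smoothTransition.nonneg _)

lemma cutoff_le_one (m x : ℝ) : cutoff m x ≤ 1 :=
  mul_le_one₀ (Real.smoothTransition.le_one _) (Real.smoothTransition.nonneg _)
    (Real.smoothTransition.le_one _)

lemma tsupport_cutoff_subset {m : ℝ} (hm : 0 < m) : tsupport (cutoff m) ⊆ Icc (1 / m) (2 * m) := by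
  refine closure_minimal (fun x hx => ?_) isClosed_Icc
  by_contra h
  rw [mem_Icc, not_and_or, not_le, not_le] at h
  apply hx
  rcases h with h | h
  · rw [lt_div_iff₀ hm] at h
    rw [cutoff, Real.smoothTransition.zero_of_nonpos (by linarith), zero_mul]
  · rw [← lt_div_iff₀ hm] at h
    rw [cutoff, Real.smoothTransition.zero_of_nonpos (x := 2 - x / m) (by linarith), mul_zero]

lemma cutoff_eq_one {m x : ℝ} (hm : 0 < m) (h1 : 2 / m ≤ x) (h2 : x ≤ m) : cutoff m x = 1 := by
  rw [div_le_iff₀ hm] at h1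
  rw [← div_le_one hm] at h2
  rw [cutoff, Real.smoothTransition.one_of_one_le (by linarith),
    Real.smoothTransition.one_of_one_le (by linarith), mul_one]

/-- The operator `x d/dx` is scale invariant: the two transition factors vary only where `m x ∈ [1,
2]` and `x / m ∈ [1, 2]`, so each contributes at most `2 K`, independently of `m`. -/
lemma exists_abs_mul_deriv_cutoff_le :
    ∃ K, 0 ≤ K ∧ ∀ m, 0 < m → ∀ x, 0 < x → |x * deriv (cutoff m) x| ≤ K := by
  obtain ⟨K, hK0, hK⟩ := exists_abs_deriv_smoothTransition_le
  refine ⟨4 * K, by positivity, fun m hm x hx => ?_⟩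
  have hd : ∀ y, HasDerivAt Real.smoothTransition (deriv Real.smoothTransition y) y := fun y =>
    ((Real.smoothTransition.contDiff (n := 1)).differentiable one_ne_zero y).hasDerivAt
  have h1 := (hd (m * x - 1)).comp x (((hasDerivAt_id x).const_mul m).sub_const 1)
  have h2 := (hd (2 - x / m)).comp x (((hasDerivAt_id x).div_const m).const_sub 2)
  have h3 := (h1.mul h2).deriv
  change deriv (cutoff m) x = _ at h3
  rw [h3]
  have b1 : |m * x * deriv Real.smoothTransition (m * x - 1)| ≤ 2 * K := by
    rcases lt_or_ge 1 (m * x - 1) with h | h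
    · rw [deriv_smoothTransition_of_one_lt h]; simpa using hK0
    · rw [abs_mul, abs_of_pos (by positivity)]
      exact mul_le_mul (by linarith) (hK _) (abs_nonneg _) (by norm_num)
  have b2 : |x / m * deriv Real.smoothTransition (2 - x / m)| ≤ 2 * K := by
    rcases lt_or_ge (2 - x / m) 0 with h | h
    · rw [deriv_smoothTransition_of_neg h]; simpa using hK0
    · rw [abs_mul, abs_of_pos (by positivity)]
      exact mul_le_mul (by linarith) (hK _) (abs_nonneg _) (by norm_num)
  have c1 : |Real.smoothTransition (2 - x / m)| ≤ 1 := by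
    rw [abs_of_nonneg (Real.smoothTransition.nonneg _)]; exact Real.smoothTransition.le_one _
  have c2 : |Real.smoothTransition (m * x - 1)| ≤ 1 := by
    rw [abs_of_nonneg (Real.smoothTransition.nonneg _)]; exact Real.smoothTransition.le_one _
  have e : x * (deriv Real.smoothTransition (m * x - 1) * (m * 1) * Real.smoothTransition (2 - x / m)
      + Real.smoothTransition (m * x - 1) * (deriv Real.smoothTransition (2 - x / m) * -(1 / m))) =
      (m * x * deriv Real.smoothTransition (m * x - 1)) * Real.smoothTransition (2 - x / m) -
      (x / m * deriv Real.smoothTransition (2 - x / m)) * Real.smoothTransition (m * x - 1) := by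
    ring
  refine (le_of_eq (congrArg _ e)).trans ((abs_sub _ _).trans ?_)
  rw [abs_mul, abs_mul (x / m * _)]
  have := mul_le_mul b1 c1 (abs_nonneg _) (by positivity)
  have := mul_le_mul b2 c2 (abs_nonneg _) (by positivity)
  linarith

lemma eventually_cutoff_eq_one {x : ℝ} (hx : 0 < x) :
    ∀ᶠ n : ℕ in atTop, cutoff (n + 1) =ᶠ[𝓝 x] fun _ => 1 := by
  have h1 : ∀ᶠ n : ℕ in atTop, 4 / x < (n : ℝ) + 1 :=
    (tendsto_natCast_atTop_atTop.atTop_add tendsto_const_nhds).eventually_gt_atTop _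
  have h2 : ∀ᶠ n : ℕ in atTop, 2 * x < (n : ℝ) + 1 :=
    (tendsto_natCast_atTop_atTop.atTop_add tendsto_const_nhds).eventually_gt_atTop _
  filter_upwards [h1, h2] with n h1 h2
  have hn : (0 : ℝ) < n + 1 := by positivity
  filter_upwards [Ioo_mem_nhds (show x / 2 < x by linarith) (show x < 2 * x by linarith)] with y hy
  refine cutoff_eq_one hn ?_ (by linarith [hy.2])
  rw [div_lt_iff₀ hx] at h1
  rw [div_le_iff₀ hn]
  nlinarith [hy.1]

lemma sqrt_mul_dSigmaStar {g : ℝ → ℝ} {x : ℝ} (hx : 0 < x) (hg : DifferentiableAt ℝ g x) :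
    √x * dSigmaStar g x = g x / 2 + x * deriv g x := by
  have h := ((Real.hasDerivAt_sqrt hx.ne').mul hg.hasDerivAt).deriv
  change dSigmaStar g x = _ at h
  have h1 := Real.sqrt_pos.2 hx
  have h2 := Real.mul_self_sqrt hx.le
  rw [h, mul_add, ← mul_assoc (√x) (√x), h2]
  field_simp

lemma stein_cutoff {α lam : ℝ} {μ : Measure ℝ} {T : ℝ → ℝ} (hT : IsSteinKernel α lam μ T)
    (hpos : ∀ᵐ x ∂μ, 0 < x) {φ : ℝ → ℝ} (hφ : ContDiff ℝ ∞ φ) {m : ℝ} (hm : 0 < m) :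
    ∫ x, (lam * x - α + 1 / 2) * (φ x * cutoff m x) ∂μ =
      ∫ x, T x * (φ x * cutoff m x / 2 + x * (deriv φ x * cutoff m x + φ x * deriv (cutoff m) x))
        ∂μ := by
  have hsupp : tsupport (fun x => φ x * cutoff m x) ⊆ Icc (1 / m) (2 * m) :=
    (tsupport_mul_subset_right).trans (tsupport_cutoff_subset hm)
  rw [hT.stein (fun x => φ x * cutoff m x) (hφ.mul (contDiff_cutoff m))
    (HasCompactSupport.of_support_subset_isCompact isCompact_Icc
      ((subset_tsupport _).trans hsupp))
    (hsupp.trans fun x hx => lt_of_lt_of_le (by positivity) hx.1)]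
  refine integral_congr_ae ?_
  filter_upwards [hpos] with x hx
  have hd1 : DifferentiableAt ℝ φ x := hφ.differentiable (by simp) x
  have hd2 : DifferentiableAt ℝ (cutoff m) x := (contDiff_cutoff m).differentiable (by simp) x
  rw [sqrt_mul_dSigmaStar (g := fun x => φ x * cutoff m x) hx (hd1.mul hd2)]
  congr 3
  exact deriv_fun_mul hd1 hd2

/-- With the cutoffs themselves as test functions, the right side of the Stein identity stays below
a multiple of `E|T(X)|`, because `x` times the cutoff's derivative is bounded uniformly. This bounds
`E[X cutoff(X)]` uniformly, and Fatou's lemma concludes. -/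
lemma integrable_id_of_stein {α lam : ℝ} (hlam : 0 < lam) {μ : Measure ℝ} [IsProbabilityMeasure μ]
    {T : ℝ → ℝ} (hT : IsSteinKernel α lam μ T) (hpos : ∀ᵐ x ∂μ, 0 < x) :
    Integrable (fun x => x) μ := by
  obtain ⟨K, hK0, hK⟩ := exists_abs_mul_deriv_cutoff_le
  have hTi := hT.integrable
  have hcm : ∀ m, Measurable (cutoff m) := fun m => (contDiff_cutoff m).continuous.measurable
  set A : ℝ := ((1 + K) * ∫ x, |T x| ∂μ) + |α - 1 / 2| with hA
  have hbound : ∀ n : ℕ, ∫⁻ x, ENNReal.ofReal (x * cutoff (n + 1) x) ∂μ ≤ ENNReal.ofReal (A / lam) := by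
    intro n
    have hn : (0 : ℝ) < n + 1 := by positivity
    have h1 := stein_cutoff hT hpos (φ := fun _ => 1) contDiff_const hn
    simp only [one_mul, deriv_const, zero_mul, zero_add] at h1
    have hci : Integrable (fun x => cutoff (n + 1) x) μ :=
      Integrable.of_bound (hcm _).aestronglyMeasurable 1 (ae_of_all _ fun x => by
        rw [Real.norm_of_nonneg (cutoff_nonneg _ _)]; exact cutoff_le_one _ _)
    have hxb : ∀ x, 0 < x → x * cutoff (n + 1) x ≤ 2 * (n + 1) := by
      intro x hx
      by_cases h : cutoff (n + 1) x = 0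
      · rw [h]; linarith
      · have := tsupport_cutoff_subset hn (subset_tsupport _ h)
        have h3 := this.2
        nlinarith [cutoff_nonneg (n + 1) x, cutoff_le_one (n + 1) x]
    have hxi : Integrable (fun x => x * cutoff (n + 1) x) μ := by
      refine Integrable.of_bound (measurable_id.mul (hcm _)).aestronglyMeasurable (2 * (n + 1)) ?_
      filter_upwards [hpos] with x hx
      rw [Real.norm_of_nonneg (mul_nonneg hx.le (cutoff_nonneg _ _))]
      exact hxb x hx
    have h2 : ∫ x, (lam * x - α + 1 / 2) * cutoff (n + 1) x ∂μ =
        lam * ∫ x, x * cutoff (n + 1) x ∂μ - (α - 1 / 2) * ∫ x, cutoff (n + 1) x ∂μ := by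
      rw [← integral_const_mul, ← integral_const_mul,
        ← integral_sub (hxi.const_mul _) (hci.const_mul _)]
      congr with x
      ring
    have h3 : ∫ x, T x * (cutoff (n + 1) x / 2 + x * deriv (cutoff (n + 1)) x) ∂μ ≤
        (1 + K) * ∫ x, |T x| ∂μ := by
      rw [← integral_const_mul]
      refine (le_abs_self _).trans (abs_integral_le_integral_abs.trans ?_)
      refine integral_mono_of_nonneg (ae_of_all _ fun x => abs_nonneg _) (hTi.abs.const_mul _) ?_
      filter_upwards [hpos] with x hx
      rw [abs_mul, mul_comm]
      refine mul_le_mul_of_nonneg_right ((abs_add_le _ _).trans ?_) (abs_nonneg _)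
      refine add_le_add ?_ (hK _ hn x hx)
      rw [abs_of_nonneg (div_nonneg (cutoff_nonneg _ _) zero_le_two)]
      linarith [cutoff_le_one (n + 1) x]
    have h4 : (α - 1 / 2) * ∫ x, cutoff (n + 1) x ∂μ ≤ |α - 1 / 2| := by
      refine (le_abs_self _).trans ?_
      rw [abs_mul]
      refine mul_le_of_le_one_right (abs_nonneg _) ?_
      rw [abs_of_nonneg (integral_nonneg fun x => cutoff_nonneg _ _)]
      calc ∫ x, cutoff (n + 1) x ∂μ ≤ ∫ _, (1 : ℝ) ∂μ :=
            integral_mono hci (integrable_const _) fun x => cutoff_le_one _ _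
        _ = 1 := by simp
    rw [← ofReal_integral_eq_lintegral_ofReal hxi]
    · refine ENNReal.ofReal_le_ofReal ?_
      rw [le_div_iff₀ hlam]
      linarith
    · filter_upwards [hpos] with x hx using mul_nonneg hx.le (cutoff_nonneg _ _)
  refine ⟨measurable_id.aestronglyMeasurable, ?_⟩
  rw [hasFiniteIntegral_iff_ofReal (hpos.mono fun x hx => hx.le)]
  have hle : ∫⁻ x, ENNReal.ofReal x ∂μ ≤
      ∫⁻ x, liminf (fun n : ℕ => ENNReal.ofReal (x * cutoff (n + 1) x)) atTop ∂μ := by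
    refine lintegral_mono_ae ?_
    filter_upwards [hpos] with x hx
    have : Tendsto (fun n : ℕ => ENNReal.ofReal (x * cutoff (n + 1) x)) atTop
        (𝓝 (ENNReal.ofReal x)) := by
      refine tendsto_const_nhds.congr' ?_
      filter_upwards [eventually_cutoff_eq_one hx] with n hn
      rw [hn.self_of_nhds, mul_one]
    exact this.liminf_eq.ge
  refine (hle.trans (lintegral_liminf_le fun n => ?_)).trans_lt ?_
  · exact (measurable_id.mul (hcm _)).ennreal_ofReal
  · refine lt_of_le_of_lt ?_ (ENNReal.ofReal_lt_top (r := A / lam))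
    exact liminf_le_of_frequently_le' (Eventually.of_forall hbound).frequently

/-- The Stein identity for smooth functions `φ` with `φ` and `x φ'` bounded. -/
lemma stein_identity {α lam : ℝ} (hlam : 0 < lam) {μ : Measure ℝ} [IsProbabilityMeasure μ]
    {T : ℝ → ℝ} (hT : IsSteinKernel α lam μ T) (hpos : ∀ᵐ x ∂μ, 0 < x) {φ : ℝ → ℝ}
    (hφ : ContDiff ℝ ∞ φ) {B : ℝ} (hB : ∀ x, 0 < x → |φ x| ≤ B)
    (hB' : ∀ x, 0 < x → |x * deriv φ x| ≤ B) :
    ∫ x, (lam * x - α + 1 / 2) * φ x ∂μ = ∫ x, T x * (φ x / 2 + x * deriv φ x) ∂μ := by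
  obtain ⟨K, hK0, hK⟩ := exists_abs_mul_deriv_cutoff_le
  have hTi := hT.integrable
  have hid := integrable_id_of_stein hlam hT hpos
  have hB0 : 0 ≤ B := (abs_nonneg _).trans (hB 1 one_pos)
  have hcm : ∀ m, Measurable (cutoff m) := fun m => (contDiff_cutoff m).continuous.measurable
  have hφm : Measurable φ := hφ.continuous.measurable
  have hφ'm : Measurable (deriv φ) := measurable_deriv φ
  have hc'm : ∀ m, Measurable (deriv (cutoff m)) := fun m => measurable_deriv _
  have hLn : ∀ n : ℕ, (0 : ℝ) < n + 1 := fun n => by positivity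
  have hlim1 : Tendsto (fun n : ℕ => ∫ x, (lam * x - α + 1 / 2) * (φ x * cutoff (n + 1) x) ∂μ) atTop
      (𝓝 (∫ x, (lam * x - α + 1 / 2) * φ x ∂μ)) := by
    refine tendsto_integral_of_dominated_convergence (fun x => |lam * x - α + 1 / 2| * B)
      (fun n => Measurable.aestronglyMeasurable (by have := hcm (n + 1); fun_prop)) ?_ (fun n => ?_) ?_
    · exact ((((hid.const_mul lam).sub (integrable_const α)).add
        (integrable_const (1 / 2))).abs).mul_const B
    · filter_upwards [hpos] with x hx
      rw [norm_mul, Real.norm_eq_abs, Real.norm_eq_abs, abs_mul]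
      refine mul_le_mul_of_nonneg_left ?_ (abs_nonneg _)
      rw [abs_of_nonneg (cutoff_nonneg _ _)]
      exact (mul_le_of_le_one_right (abs_nonneg _) (cutoff_le_one _ _)).trans (hB x hx)
    · filter_upwards [hpos] with x hx
      refine tendsto_const_nhds.congr' ?_
      filter_upwards [eventually_cutoff_eq_one hx] with n hn
      rw [hn.self_of_nhds, mul_one]
  have hlim2 : Tendsto (fun n : ℕ => ∫ x, T x * (φ x * cutoff (n + 1) x / 2 +
      x * (deriv φ x * cutoff (n + 1) x + φ x * deriv (cutoff (n + 1)) x)) ∂μ) atTop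
      (𝓝 (∫ x, T x * (φ x / 2 + x * deriv φ x) ∂μ)) := by
    -- The summands `B`, `B`, `B * K` bound respectively the terms with `φ / 2`, with `x φ'`, and
    -- with the derivative of the cutoff.
    refine tendsto_integral_of_dominated_convergence (fun x => |T x| * (B + B + B * K))
      (fun n => hTi.aestronglyMeasurable.mul (Measurable.aestronglyMeasurable (by
        have := hcm (n + 1); have := hc'm (n + 1); fun_prop))) (hTi.abs.mul_const _) (fun n => ?_) ?_
    · filter_upwards [hpos] with x hx
      rw [norm_mul, Real.norm_eq_abs, Real.norm_eq_abs]
      refine mul_le_mul_of_nonneg_left ?_ (abs_nonneg _)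
      have e : φ x * cutoff (n + 1) x / 2 +
          x * (deriv φ x * cutoff (n + 1) x + φ x * deriv (cutoff (n + 1)) x) =
          φ x * (cutoff (n + 1) x / 2) + (x * deriv φ x) * cutoff (n + 1) x +
          φ x * (x * deriv (cutoff (n + 1)) x) := by ring
      rw [e]
      have hc0 := cutoff_nonneg (n + 1) x
      have hc1 := cutoff_le_one (n + 1) x
      refine (abs_add_le _ _).trans (add_le_add ((abs_add_le _ _).trans (add_le_add ?_ ?_)) ?_)
      · rw [abs_mul, abs_of_nonneg (show 0 ≤ cutoff (n + 1) x / 2 by linarith)]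
        exact (mul_le_of_le_one_right (abs_nonneg _) (by linarith)).trans (hB x hx)
      · rw [abs_mul, abs_of_nonneg hc0]
        exact (mul_le_of_le_one_right (abs_nonneg _) hc1).trans (hB' x hx)
      · rw [abs_mul]
        exact mul_le_mul (hB x hx) (hK _ (hLn n) x hx) (abs_nonneg _) hB0
    · filter_upwards [hpos] with x hx
      refine tendsto_const_nhds.congr' ?_
      filter_upwards [eventually_cutoff_eq_one hx] with n hn
      rw [hn.self_of_nhds, hn.deriv_eq, deriv_const]
      ring
  refine tendsto_nhds_unique hlim1 (hlim2.congr fun n => ?_)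
  exact (stein_cutoff hT hpos hφ (hLn n)).symm

/-! ### The relative density of the path, its score, and the Stein identity for its kernel -/

/-- The density at `u` of the smart path started from `μ`, relative to the gamma law `(α, r)`. -/
noncomputable def relDensity (α r τ : ℝ) (μ : Measure ℝ) (u : ℝ) : ℝ :=
  ∫ x, Real.exp (-(r * τ * x)) * hypF α (r ^ 2 * τ * u * x) ∂μ

/-- The derivative of `relDensity`. -/
noncomputable def relDensityDeriv (α r τ : ℝ) (μ : Measure ℝ) (u : ℝ) : ℝ :=
  (∫ x, Real.exp (-(r * τ * x)) * x * hypF (α + 1) (r ^ 2 * τ * u * x) ∂μ) / α * (r ^ 2 * τ)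

/-- The function `∂^σ v_τ`, in terms of `relDensity`. -/
noncomputable def relScore (α r τ : ℝ) (μ : Measure ℝ) (u : ℝ) : ℝ :=
  √u * (relDensityDeriv α r τ μ u / relDensity α r τ μ u - r * τ)

lemma exp_neg_mul_exp_sqrt_le {c : ℝ} (hc : 0 < c) (C : ℝ) {x : ℝ} (hx : 0 ≤ x) :
    Real.exp (-(c * x)) * Real.exp (C * √x) ≤ Real.exp (C ^ 2 / (4 * c)) := by
  rw [← Real.exp_add, Real.exp_le_exp]
  have h1 := Real.sq_sqrt hx
  have h2 : C ^ 2 / (4 * c) - (-(c * x) + C * √x) = (C - 2 * c * √x) ^ 2 / (4 * c) := by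
    rw [sub_sq, mul_pow, h1]; field_simp; ring
  have h3 : 0 ≤ (C - 2 * c * √x) ^ 2 / (4 * c) := by positivity
  linarith

lemma hasSqrtExpMoments_exp_neg {μ : Measure ℝ} [IsFiniteMeasure μ] (hpos : ∀ᵐ x ∂μ, 0 < x)
    {c : ℝ} (hc : 0 < c) : HasSqrtExpMoments μ (fun x => Real.exp (-(c * x))) := by
  intro C
  refine Integrable.of_bound (by fun_prop) (Real.exp (C ^ 2 / (4 * c))) ?_
  filter_upwards [hpos] with x hx
  rw [Real.norm_of_nonneg (by positivity)]
  exact exp_neg_mul_exp_sqrt_le hc C hx.le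

section

variable {α r τ : ℝ} {μ : Measure ℝ}

lemma integrable_relDensity [IsFiniteMeasure μ] (hα : 1 / 2 ≤ α) (hr : 0 < r) (hτ : 0 < τ)
    (hpos : ∀ᵐ x ∂μ, 0 < x) {u : ℝ} (hu : 0 ≤ u) :
    Integrable (fun x => Real.exp (-(r * τ * x)) * hypF α (r ^ 2 * τ * u * x)) μ :=
  ((hasSqrtExpMoments_exp_neg hpos (mul_pos hr hτ)).mul_hypF (hpos.mono fun _ h => h.le) hα
    (by positivity)).integrable

lemma integrable_relDensityDeriv [IsFiniteMeasure μ] (hα : 1 / 2 ≤ α) (hr : 0 < r) (hτ : 0 < τ)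
    (hpos : ∀ᵐ x ∂μ, 0 < x) {u : ℝ} (hu : 0 ≤ u) :
    Integrable (fun x => Real.exp (-(r * τ * x)) * x * hypF (α + 1) (r ^ 2 * τ * u * x)) μ :=
  (((hasSqrtExpMoments_exp_neg hpos (mul_pos hr hτ)).mul_id (hpos.mono fun _ h => h.le)).mul_hypF
    (hpos.mono fun _ h => h.le) (show 1 / 2 ≤ α + 1 by linarith) (by positivity)).integrable

lemma hasDerivAt_relDensity [IsFiniteMeasure μ] (hα : 1 / 2 ≤ α) (hr : 0 < r) (hτ : 0 < τ)
    (hpos : ∀ᵐ x ∂μ, 0 < x) {u : ℝ} (hu : 0 < u) :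
    HasDerivAt (relDensity α r τ μ) (relDensityDeriv α r τ μ u) u := by
  have h1 := hasDerivAt_integral_hypF (hasSqrtExpMoments_exp_neg hpos (mul_pos hr hτ))
    (hpos.mono fun _ h => h.le) hα (show 0 < r ^ 2 * τ * u by positivity)
  have h2 := h1.comp u ((hasDerivAt_id u).const_mul (r ^ 2 * τ))
  refine h2.congr_deriv ?_
  rw [relDensityDeriv, mul_one]

lemma integral_exp_neg_pos [IsProbabilityMeasure μ] (hr : 0 < r) (hτ : 0 < τ)
    (hpos : ∀ᵐ x ∂μ, 0 < x) : 0 < ∫ x, Real.exp (-(r * τ * x)) ∂μ :=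
  integral_exp_pos (hasSqrtExpMoments_exp_neg hpos (mul_pos hr hτ)).integrable

lemma le_relDensity [IsProbabilityMeasure μ] (hα : 1 / 2 ≤ α) (hr : 0 < r) (hτ : 0 < τ)
    (hpos : ∀ᵐ x ∂μ, 0 < x) {u : ℝ} (hu : 0 ≤ u) :
    ∫ x, Real.exp (-(r * τ * x)) ∂μ ≤ relDensity α r τ μ u := by
  refine integral_mono_ae (hasSqrtExpMoments_exp_neg hpos (mul_pos hr hτ)).integrable
    (integrable_relDensity hα hr hτ hpos hu) ?_
  filter_upwards [hpos] with x hx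
  exact le_mul_of_one_le_right (Real.exp_pos _).le (one_le_hypF hα (by positivity))

lemma relDensity_pos [IsProbabilityMeasure μ] (hα : 1 / 2 ≤ α) (hr : 0 < r) (hτ : 0 < τ)
    (hpos : ∀ᵐ x ∂μ, 0 < x) {u : ℝ} (hu : 0 ≤ u) : 0 < relDensity α r τ μ u :=
  (integral_exp_neg_pos hr hτ hpos).trans_le (le_relDensity hα hr hτ hpos hu)

lemma relDensityDeriv_nonneg (hα : 1 / 2 ≤ α) (hτ : 0 < τ)
    (hpos : ∀ᵐ x ∂μ, 0 < x) {u : ℝ} (hu : 0 ≤ u) : 0 ≤ relDensityDeriv α r τ μ u := by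
  have : 0 ≤ ∫ x, Real.exp (-(r * τ * x)) * x * hypF (α + 1) (r ^ 2 * τ * u * x) ∂μ := by
    refine integral_nonneg_of_ae ?_
    filter_upwards [hpos] with x hx
    have := (hypF_pos (show 1 / 2 ≤ α + 1 by linarith) (show 0 ≤ r ^ 2 * τ * u * x by positivity)).le
    positivity
  have hα0 : 0 < α := by linarith
  unfold relDensityDeriv
  positivity

lemma measurable_relDensity [SFinite μ] (hα : 1 / 2 ≤ α) (r τ : ℝ) :
    Measurable (relDensity α r τ μ) := by
  have hc := continuous_hypF hα
  have : StronglyMeasurable fun p : ℝ × ℝ =>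
      Real.exp (-(r * τ * p.2)) * hypF α (r ^ 2 * τ * p.1 * p.2) :=
    Continuous.stronglyMeasurable (by fun_prop)
  exact this.integral_prod_right'.measurable

lemma measurable_relDensityDeriv [SFinite μ] (hα : 1 / 2 ≤ α) (r τ : ℝ) :
    Measurable (relDensityDeriv α r τ μ) := by
  have hc := continuous_hypF (show 1 / 2 ≤ α + 1 by linarith)
  have : StronglyMeasurable fun p : ℝ × ℝ =>
      Real.exp (-(r * τ * p.2)) * p.2 * hypF (α + 1) (r ^ 2 * τ * p.1 * p.2) :=
    Continuous.stronglyMeasurable (by fun_prop)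
  exact (this.integral_prod_right'.measurable.div_const α).mul_const _

lemma measurable_relScore [SFinite μ] (hα : 1 / 2 ≤ α) (r τ : ℝ) :
    Measurable (relScore α r τ μ) := by
  have h1 := measurable_relDensity (μ := μ) hα r τ
  have h2 := measurable_relDensityDeriv (μ := μ) hα r τ
  unfold relScore
  fun_prop

lemma sqrt_mul_exp_neg_le {c : ℝ} (hc : 0 < c) {x : ℝ} (hx : 0 ≤ x) :
    √x * Real.exp (-(c * x)) ≤ 1 / √c := by
  have h1 := Real.add_one_le_exp (c * x)
  have h2 := Real.sq_sqrt hx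
  have h3 := Real.sq_sqrt hc.le
  have h4 := Real.sqrt_pos.2 hc
  rw [le_div_iff₀ h4, Real.exp_neg, mul_right_comm, ← div_eq_mul_inv, div_le_one (Real.exp_pos _)]
  nlinarith [sq_nonneg (√x * √c - 1), Real.sqrt_nonneg x]

/-- The inequality `√y F' ≤ F` trades the factor `√u x F'` for `√x F`. What remains is to replace
`√x` by a multiple of `√u`, up to a bounded error. -/
lemma sqrt_mul_relDensityDeriv_integrand_le (hα : 1 / 2 ≤ α) (hr : 0 < r) (hτ : 0 < τ)
    {u x : ℝ} (hu : 0 ≤ u) (hx : 0 < x) :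
    √u * (Real.exp (-(r * τ * x)) * x * hypF (α + 1) (r ^ 2 * τ * u * x) / α * (r ^ 2 * τ)) ≤
      4 * r * √u * (Real.exp (-(r * τ * x)) * hypF α (r ^ 2 * τ * u * x)) +
        r * √τ * (1 / √(r * τ / 2)) := by
  set y := r ^ 2 * τ * u * x with hy
  have hy0 : 0 ≤ y := by positivity
  have hF := hypF_pos hα hy0
  have hF1 := hypF_pos (show 1 / 2 ≤ α + 1 by linarith) hy0
  have hsy : √y = r * √τ * √u * √x := by
    rw [hy, Real.sqrt_mul (by positivity), Real.sqrt_mul (by positivity),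
      Real.sqrt_mul (by positivity), Real.sqrt_sq hr.le]
  have hsx := Real.mul_self_sqrt hx.le
  have hsτ := Real.mul_self_sqrt hτ.le
  have hτ' := Real.sqrt_pos.2 hτ
  have h1 : √u * (Real.exp (-(r * τ * x)) * x * hypF (α + 1) y / α * (r ^ 2 * τ)) =
      r * √τ * (Real.exp (-(r * τ * x)) * √x * (√y * (hypF (α + 1) y / α))) := by
    rw [hsy]
    calc _ = r * (√τ * √τ) * r * √u * (√x * √x) * Real.exp (-(r * τ * x)) *
          (hypF (α + 1) y / α) := by rw [hsx, hsτ]; ring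
      _ = _ := by ring
  have h2 := sqrt_mul_deriv_hypF_le hα hy0
  have h3 : Real.exp (-(r * τ * x)) * √x * (√y * (hypF (α + 1) y / α)) ≤
      Real.exp (-(r * τ * x)) * √x * hypF α y := by gcongr
  have h4 : Real.exp (-(r * τ * x)) * √x * hypF α y ≤
      4 / √τ * √u * (Real.exp (-(r * τ * x)) * hypF α y) + 1 / √(r * τ / 2) := by
    have hc : 0 ≤ 1 / √(r * τ / 2) := by positivity
    -- If `√x` is at most `4 √u / √τ`, substitute. Otherwise the threshold `4` makes `2 √y ≤ r τ x /
    -- 2`, so `F(y)` consumes only half of the decay `e^{-rτx}`, and the other half absorbs `√x`.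
    rcases le_total (√x) (4 / √τ * √u) with h | h
    · have : Real.exp (-(r * τ * x)) * √x * hypF α y ≤
          Real.exp (-(r * τ * x)) * (4 / √τ * √u) * hypF α y := by gcongr
      linarith
    · have h5 : 2 * √y ≤ r * τ / 2 * x := by
        have : √u ≤ √τ * √x / 4 := by
          rw [div_mul_eq_mul_div, div_le_iff₀ hτ'] at h
          linarith
        rw [hsy]
        calc 2 * (r * √τ * √u * √x) ≤ 2 * (r * √τ * (√τ * √x / 4) * √x) := by gcongr
          _ = r * (√τ * √τ) / 2 * (√x * √x) := by ring
          _ = _ := by rw [hsx, hsτ]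
      have h6 : hypF α y ≤ Real.exp (r * τ / 2 * x) :=
        (hypF_le_exp hα hy0).trans (Real.exp_le_exp.2 h5)
      have h7 : Real.exp (-(r * τ * x)) * √x * hypF α y ≤ 1 / √(r * τ / 2) := by
        refine le_trans ?_ (sqrt_mul_exp_neg_le (show 0 < r * τ / 2 by positivity) hx.le)
        calc _ ≤ Real.exp (-(r * τ * x)) * √x * Real.exp (r * τ / 2 * x) := by gcongr
          _ = √x * (Real.exp (-(r * τ * x)) * Real.exp (r * τ / 2 * x)) := by ring
          _ = _ := by rw [← Real.exp_add]; congr 2; ring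
      have : 0 ≤ 4 / √τ * √u * (Real.exp (-(r * τ * x)) * hypF α y) := by positivity
      linarith
  rw [h1]
  calc _ ≤ r * √τ * (4 / √τ * √u * (Real.exp (-(r * τ * x)) * hypF α y) + 1 / √(r * τ / 2)) := by
        gcongr
        exact h3.trans h4
    _ = _ := by field_simp

/-- Integrating the pointwise bound gives `√u N' ≤ 4 r √u N + A`, and dividing by `N` is harmless
since `N` is bounded below by `E[e^{-rτX}] > 0`. Square growth at most linear is what makes a first
moment of the path suffice for finite information. -/
lemma exists_abs_relScore_le [IsProbabilityMeasure μ] (hα : 1 / 2 ≤ α) (hr : 0 < r) (hτ : 0 < τ)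
    (hpos : ∀ᵐ x ∂μ, 0 < x) :
    ∃ C, 0 ≤ C ∧ ∀ u, 0 ≤ u → |relScore α r τ μ u| ≤ C * (1 + √u) := by
  set N0 := ∫ x, Real.exp (-(r * τ * x)) ∂μ with hN0
  have hN0p : 0 < N0 := integral_exp_neg_pos hr hτ hpos
  set A := r * √τ * (1 / √(r * τ / 2)) with hA
  have hA0 : 0 ≤ A := by positivity
  refine ⟨4 * r + A / N0 + r * τ, by positivity, fun u hu => ?_⟩
  have hN := relDensity_pos hα hr hτ hpos hu
  have hN1 := relDensityDeriv_nonneg (r := r) hα hτ hpos hu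
  have hle := le_relDensity hα hr hτ hpos hu
  have h1 : √u * relDensityDeriv α r τ μ u ≤ 4 * r * √u * relDensity α r τ μ u + A := by
    have e : √u * relDensityDeriv α r τ μ u = ∫ x, √u * (Real.exp (-(r * τ * x)) * x *
        hypF (α + 1) (r ^ 2 * τ * u * x) / α * (r ^ 2 * τ)) ∂μ := by
      rw [integral_const_mul, integral_mul_const, integral_div, relDensityDeriv]
    have e2 : 4 * r * √u * relDensity α r τ μ u + A = ∫ x, (4 * r * √u * (Real.exp (-(r * τ * x)) *
        hypF α (r ^ 2 * τ * u * x)) + A) ∂μ := by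
      rw [integral_add ((integrable_relDensity hα hr hτ hpos hu).const_mul _) (integrable_const _),
        integral_const_mul, relDensity]
      simp
    rw [e, e2]
    refine integral_mono_ae ((((integrable_relDensityDeriv hα hr hτ hpos hu).div_const α).mul_const
      _).const_mul _) (((integrable_relDensity hα hr hτ hpos hu).const_mul _).add
      (integrable_const _)) ?_
    filter_upwards [hpos] with x hx using sqrt_mul_relDensityDeriv_integrand_le hα hr hτ hu hx
  have h2 : √u * (relDensityDeriv α r τ μ u / relDensity α r τ μ u) ≤ 4 * r * √u + A / N0 := by
    rw [← mul_div_assoc, div_le_iff₀ hN]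
    have : A ≤ A / N0 * relDensity α r τ μ u := by
      rw [div_mul_eq_mul_div, le_div_iff₀ hN0p]; gcongr
    linarith
  have h3 : 0 ≤ √u * (relDensityDeriv α r τ μ u / relDensity α r τ μ u) := by positivity
  have hsu := Real.sqrt_nonneg u
  have h4 : 0 ≤ A / N0 := by positivity
  have h5 : 0 ≤ r * τ := by positivity
  rw [relScore, mul_sub, abs_le]
  constructor <;> nlinarith

/-- The Stein identity, applied to the kernel of the smart path at the point `u`. -/
lemma integral_stein_kernel {lam : ℝ} {T : ℝ → ℝ} [IsProbabilityMeasure μ] (hα : 1 / 2 ≤ α)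
    (hlam : 0 < lam) (hτ : 0 < τ) (hr : 0 < r) (hlr : lam = r * (1 - τ))
    (hT : IsSteinKernel α lam μ T) (hpos : ∀ᵐ x ∂μ, 0 < x) {u : ℝ} (hu : 0 < u) :
    ∫ x, (T x - 1) * (Real.exp (-(r * τ * x)) * (2 * hypF α (r ^ 2 * τ * u * x) +
      (1 - 2 * α - 2 * (r * τ * x)) * (hypF (α + 1) (r ^ 2 * τ * u * x) / α))) ∂μ =
      2 / (r * τ) * (relDensityDeriv α r τ μ u - r * τ * relDensity α r τ μ u) := by
  have hα0 : 0 < α := by linarith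
  have hα1 : 1 / 2 ≤ α + 1 := by linarith
  have hα2 : 1 / 2 ≤ α + 1 + 1 := by linarith
  have hrτ : 0 < r * τ := by positivity
  set c := r ^ 2 * τ * u with hc
  have hc0 : 0 < c := by positivity
  -- The test function `e^{-rτx} F'(c x)`, chosen so that the kernel to be integrated is `2 (φ / 2 +
  -- x φ')`; this is `hker` below, which rests on the differential equation.
  set φ : ℝ → ℝ := fun x => Real.exp (-(r * τ * x)) * (hypF (α + 1) (c * x) / α) with hφ
  have hφc : ContDiff ℝ ∞ φ := by
    refine ContDiff.mul (by fun_prop) (ContDiff.div_const ?_ _)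
    exact (contDiff_hypF hα1).comp (by fun_prop)
  have hφd : ∀ x, deriv φ x = Real.exp (-(r * τ * x)) *
      (-(r * τ) * (hypF (α + 1) (c * x) / α) + c * (hypF (α + 2) (c * x) / (α * (α + 1)))) := by
    intro x
    have h1 := (((hasDerivAt_id x).const_mul (r * τ)).neg).exp
    have h2 := ((hasDerivAt_hypF hα1 (c * x)).comp x ((hasDerivAt_id x).const_mul c)).div_const α
    refine ((h1.mul h2).congr_deriv ?_).deriv
    rw [show α + 1 + 1 = α + 2 by ring]
    simp only [id, mul_one, Function.comp_apply, Pi.neg_apply]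
    field_simp
  have hexp : ∀ a, 1 / 2 ≤ a → ∀ x, 0 < x → hypF a (c * x) ≤ Real.exp (2 * √c * √x) := by
    intro a ha x hx
    refine (hypF_le_exp ha (by positivity)).trans (le_of_eq ?_)
    rw [Real.sqrt_mul hc0.le, mul_assoc]
  obtain ⟨B, hB1, hB2⟩ : ∃ B, (∀ x, 0 < x → |φ x| ≤ B) ∧ ∀ x, 0 < x → |x * deriv φ x| ≤ B := by
    set D := Real.exp ((2 * √c) ^ 2 / (4 * (r * τ))) with hD
    set E := Real.exp ((2 * √c + 1) ^ 2 / (4 * (r * τ))) with hE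
    have h1 : ∀ x, 0 < x → φ x ≤ D / α := by
      intro x hx
      change Real.exp (-(r * τ * x)) * (hypF (α + 1) (c * x) / α) ≤ _
      rw [← mul_div_assoc]
      refine div_le_div_of_nonneg_right ?_ hα0.le
      refine le_trans ?_ (exp_neg_mul_exp_sqrt_le hrτ (2 * √c) hx.le)
      exact mul_le_mul_of_nonneg_left (hexp _ hα1 x hx) (Real.exp_pos _).le
    have h0 : ∀ x, 0 < x → 0 ≤ φ x := fun x hx => by
      have := hypF_pos hα1 (show 0 ≤ c * x by positivity)
      positivity
    have hx2 : ∀ a, 1 / 2 ≤ a → ∀ x, 0 < x →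
        x * (Real.exp (-(r * τ * x)) * hypF a (c * x)) ≤ 2 * E := by
      intro a ha x hx
      have := exp_neg_mul_exp_sqrt_le hrτ (2 * √c + 1) hx.le
      have h3 := hypF_pos ha (show 0 ≤ c * x by positivity)
      calc x * (Real.exp (-(r * τ * x)) * hypF a (c * x))
          ≤ (2 * Real.exp √x) * (Real.exp (-(r * τ * x)) * Real.exp (2 * √c * √x)) := by
            gcongr
            · exact le_two_mul_exp_sqrt hx.le
            · exact hexp a ha x hx
        _ = 2 * (Real.exp (-(r * τ * x)) * Real.exp ((2 * √c + 1) * √x)) := by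
            rw [add_mul, one_mul, Real.exp_add]; ring
        _ ≤ 2 * E := by gcongr
    refine ⟨max (D / α) (r * τ / α * (2 * E) + c / (α * (α + 1)) * (2 * E)), fun x hx => ?_,
      fun x hx => ?_⟩
    · rw [abs_of_nonneg (h0 x hx)]
      exact (h1 x hx).trans (le_max_left _ _)
    · refine le_trans ?_ (le_max_right _ _)
      have e : x * deriv φ x = -(r * τ / α * (x * (Real.exp (-(r * τ * x)) * hypF (α + 1) (c * x)))) +
          c / (α * (α + 1)) * (x * (Real.exp (-(r * τ * x)) * hypF (α + 1 + 1) (c * x))) := by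
        rw [hφd, show α + 1 + 1 = α + 2 by ring]
        field_simp
      rw [e]
      have p1 := hypF_pos hα1 (show 0 ≤ c * x by positivity)
      have p2 := hypF_pos hα2 (show 0 ≤ c * x by positivity)
      refine (abs_add_le _ _).trans ?_
      rw [abs_neg, abs_of_nonneg (by positivity), abs_of_nonneg (by positivity)]
      have := hx2 _ hα1 x hx
      have := hx2 _ hα2 x hx
      gcongr
  have hst := stein_identity hlam hT hpos hφc hB1 hB2
  have hker : ∀ x, Real.exp (-(r * τ * x)) * (2 * hypF α (c * x) +
      (1 - 2 * α - 2 * (r * τ * x)) * (hypF (α + 1) (c * x) / α)) =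
      2 * (φ x / 2 + x * deriv φ x) := by
    intro x
    rw [hφd, hφ, hypF_ode hα (c * x)]
    field_simp
    ring
  have hbd : ∀ᵐ x ∂μ, ‖φ x / 2 + x * deriv φ x‖ ≤ B + B := by
    filter_upwards [hpos] with x hx
    refine (norm_add_le _ _).trans (add_le_add ?_ (hB2 x hx))
    rw [norm_div, Real.norm_eq_abs, Real.norm_two]
    linarith [hB1 x hx, abs_nonneg (φ x)]
  have hmeas : AEStronglyMeasurable (fun x => φ x / 2 + x * deriv φ x) μ := by
    have h1 := hφc.continuous.measurable
    have h2 := measurable_deriv φ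
    exact Measurable.aestronglyMeasurable (by fun_prop)
  have hi1 : Integrable (fun x => φ x / 2 + x * deriv φ x) μ := Integrable.of_bound hmeas _ hbd
  have hi2 : Integrable (fun x => T x * (φ x / 2 + x * deriv φ x)) μ :=
    hT.integrable.mul_bdd hmeas hbd
  simp_rw [hker]
  have e1 : ∫ x, (T x - 1) * (2 * (φ x / 2 + x * deriv φ x)) ∂μ =
      2 * ∫ x, (lam * x - α + 1 / 2) * φ x ∂μ - 2 * ∫ x, (φ x / 2 + x * deriv φ x) ∂μ := by
    rw [hst, ← integral_const_mul, ← integral_const_mul,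
      ← integral_sub (hi2.const_mul 2) (hi1.const_mul 2)]
    congr with x
    ring
  have hid := integrable_id_of_stein hlam hT hpos
  have hi3 : Integrable (fun x => (lam * x - α + 1 / 2) * φ x) μ := by
    refine (((hid.const_mul lam).sub (integrable_const α)).add (integrable_const (1 / 2))).mul_bdd
      hφc.continuous.aestronglyMeasurable (c := B) ?_
    filter_upwards [hpos] with x hx using hB1 x hx
  have hj0 := integrable_relDensity hα hr hτ hpos hu.le
  have hj1 := integrable_relDensityDeriv hα hr hτ hpos hu.le
  have e2 : 2 / (r * τ) * (relDensityDeriv α r τ μ u - r * τ * relDensity α r τ μ u) =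
      2 * r / α * ∫ x, Real.exp (-(r * τ * x)) * x * hypF (α + 1) (c * x) ∂μ -
        2 * ∫ x, Real.exp (-(r * τ * x)) * hypF α (c * x) ∂μ := by
    rw [relDensityDeriv, relDensity, ← hc]
    generalize (∫ x, Real.exp (-(r * τ * x)) * x * hypF (α + 1) (c * x) ∂μ) = I1
    generalize (∫ x, Real.exp (-(r * τ * x)) * hypF α (c * x) ∂μ) = I0
    field_simp
  rw [e1, e2, ← integral_const_mul, ← integral_const_mul, ← integral_const_mul,
    ← integral_const_mul, ← integral_sub (hi3.const_mul 2) (hi1.const_mul 2),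
    ← integral_sub (hj1.const_mul _) (hj0.const_mul _)]
  congr with x
  -- The terms in `1 - 2α` cancel, and the two multiples of `x` combine through `lam + r τ = r`,
  -- leaving `2 r x F' - 2 F`.
  rw [← hker, hlr, hφ]
  ring

end

/-! ### The law of the path, its Fisher information, and the semigroup -/

section

variable {α lam r τ : ℝ} {μ : Measure ℝ}

lemma measurable_ncGamma_comp (hα : 1 / 2 ≤ α) (r c : ℝ) :
    Measurable fun x => ncGamma α r (c * x) := by
  refine Measure.measurable_of_measurable_coe _ fun s hs => ?_
  have hm : Measurable fun p : ℝ × ℝ => ENNReal.ofReal (ncGammaPDF α r (c * p.1) p.2) := by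
    have := (continuous_hypF hα).measurable
    unfold ncGammaPDF
    fun_prop
  simp_rw [ncGamma, withDensity_apply _ hs]
  exact hm.lintegral_prod_right'

/-- The mixture of noncentral gamma laws in the smart path, as a measure with a density relative
to the gamma law `(α, r)`. -/
lemma bind_ncGamma [IsProbabilityMeasure μ] (hα : 1 / 2 ≤ α) (hr : 0 < r) (hτ : 0 < τ)
    (hpos : ∀ᵐ x ∂μ, 0 < x) :
    μ.bind (fun x => ncGamma α r (r * τ * x)) =
      (gammaMeasure α r).withDensity fun u => ENNReal.ofReal (relDensity α r τ μ u) := by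
  have hc := continuous_hypF hα
  have hN := measurable_relDensity (μ := μ) hα r τ
  have hγ : Measurable (gammaPDF α r) := by unfold gammaPDF; fun_prop
  have hm : Measurable fun p : ℝ × ℝ => ENNReal.ofReal (ncGammaPDF α r (r * τ * p.1) p.2) := by
    unfold ncGammaPDF
    fun_prop
  ext s hs
  rw [Measure.bind_apply hs (measurable_ncGamma_comp hα r (r * τ)).aemeasurable,
    gammaMeasure_eq_restrict, ← withDensity_mul _ hγ (by fun_prop), withDensity_apply _ hs,
    Measure.restrict_restrict hs]
  simp_rw [ncGamma, withDensity_apply _ hs, Measure.restrict_restrict hs]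
  rw [lintegral_lintegral_swap hm.aemeasurable]
  refine setLIntegral_congr_fun (hs.inter measurableSet_Ioi) fun u hu => ?_
  have hu0 : 0 < u := hu.2
  rw [Pi.mul_apply, relDensity, ofReal_integral_eq_lintegral_ofReal
    (integrable_relDensity hα hr hτ hpos hu0.le), ← lintegral_const_mul _ (by fun_prop)]
  · refine lintegral_congr fun x => ?_
    rw [gammaPDF, ← ENNReal.ofReal_mul (gammaPDFReal_nonneg (by linarith) hr u), ncGammaPDF]
    congr 4
    ring
  · filter_upwards [hpos] with x hx
    have := hypF_pos hα (show 0 ≤ r ^ 2 * τ * u * x by positivity)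
    positivity

lemma smartPathLaw_eq [IsProbabilityMeasure μ] (hα : 1 / 2 ≤ α) (hlam : 0 < lam) (hτ0 : 0 < τ)
    (hτ1 : τ < 1) (hr : r = lam / (1 - τ)) (hpos : ∀ᵐ x ∂μ, 0 < x) :
    smartPathLaw α lam τ μ =
      (gammaMeasure α r).withDensity fun u => ENNReal.ofReal (relDensity α r τ μ u) := by
  have h1τ : 0 < 1 - τ := sub_pos.2 hτ1
  have hr0 : 0 < r := hr ▸ by positivity
  rw [← bind_ncGamma hα hr0 hτ0 hpos, smartPathLaw]
  refine Measure.bind_congr_right ?_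
  filter_upwards [hpos] with x hx
  rw [poisson_bind_gamma_eq_ncGamma hα hlam hτ0 hτ1 (by positivity), hr]
  congr 1
  ring

lemma shiftedGaussian_eq (hlam : 0 < lam) (hτ0 : 0 < τ) (hτ1 : τ < 1) (hr : r = lam / (1 - τ))
    (x z : ℝ) :
    shiftedGaussian lam τ x z = √((1 - τ) / (2 * lam)) * (z + √(2 * r * τ * x)) := by
  have h1τ : 0 < 1 - τ := sub_pos.2 hτ1
  rw [shiftedGaussian, mul_add, ← Real.sqrt_mul hτ0.le, ← Real.sqrt_mul (by positivity), add_comm,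
    show (1 - τ) / (2 * lam) * (2 * r * τ * x) = τ * x by rw [hr]; field_simp]

lemma pathPoint_eq (hlam : 0 < lam) (hτ0 : 0 < τ) (hτ1 : τ < 1) (hr : r = lam / (1 - τ))
    (x z g : ℝ) :
    pathPoint lam τ x z g = (z + √(2 * r * τ * x)) ^ 2 / (2 * r) + (1 - τ) * g := by
  have h1τ : 0 < 1 - τ := sub_pos.2 hτ1
  rw [pathPoint, shiftedGaussian_eq hlam hτ0 hτ1 hr, mul_pow, Real.sq_sqrt (by positivity), hr]
  field_simp
  ring

lemma measurable_pathPoint (lam τ : ℝ) :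
    Measurable fun p : ℝ × ℝ × ℝ => pathPoint lam τ p.1 p.2.1 p.2.2 := by
  unfold pathPoint shiftedGaussian
  fun_prop

/-- Given `X = x`, the Gaussian shift is `b = √(2rτx)`, so its noncentrality `b² / 2 = rτx` is the
Poisson parameter of the smart path. Averaging over `X` therefore gives the same mixture as in
`smartPathLaw_eq`. -/
lemma map_pathPoint [IsProbabilityMeasure μ] (hα : 1 / 2 ≤ α) (hlam : 0 < lam) (hτ0 : 0 < τ)
    (hτ1 : τ < 1) (hr : r = lam / (1 - τ)) (hpos : ∀ᵐ x ∂μ, 0 < x) :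
    (μ.prod ((gaussianReal 0 1).prod (gammaLaw (α - 1 / 2) lam))).map
      (fun p : ℝ × ℝ × ℝ => pathPoint lam τ p.1 p.2.1 p.2.2) =
      (gammaMeasure α r).withDensity fun u => ENNReal.ofReal (relDensity α r τ μ u) := by
  have h1τ : 0 < 1 - τ := sub_pos.2 hτ1
  have hr0 : 0 < r := hr ▸ by positivity
  have hlr : lam = r * (1 - τ) := by rw [hr]; field_simp
  have := isProbabilityMeasure_gammaLaw (show 0 ≤ α - 1 / 2 by linarith) hlam
  have hm := measurable_pathPoint lam τ
  rw [← bind_ncGamma hα hr0 hτ0 hpos]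
  ext s hs
  rw [Measure.bind_apply hs (measurable_ncGamma_comp hα r (r * τ)).aemeasurable,
    Measure.map_apply hm hs, Measure.prod_apply (hm hs)]
  refine lintegral_congr_ae ?_
  filter_upwards [hpos] with x hx
  have h := map_gaussian_gamma_eq_ncGamma hα hr0 h1τ (√(2 * r * τ * x))
  rw [Real.sq_sqrt (by positivity), show 2 * r * τ * x / 2 = r * τ * x by ring, ← hlr] at h
  rw [← h, Measure.map_apply (by fun_prop) hs]
  congr 1
  ext p
  simp only [mem_preimage]
  rw [pathPoint_eq hlam hτ0 hτ1 hr]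

lemma relDensity_measure_eq (hα : 1 / 2 ≤ α) (hr : 0 < r) [SFinite μ] :
    ((gammaMeasure α r).withDensity fun u => ENNReal.ofReal (relDensity α r τ μ u)) =
      (volume.restrict (Ioi 0)).withDensity fun u =>
        ENNReal.ofReal (gammaPDFReal α r u * relDensity α r τ μ u) := by
  have hN := measurable_relDensity (μ := μ) hα r τ
  rw [gammaMeasure_eq_restrict, ← withDensity_mul _ (by unfold gammaPDF; fun_prop) (by fun_prop)]
  congr with u
  rw [Pi.mul_apply, gammaPDF, ENNReal.ofReal_mul (gammaPDFReal_nonneg (by linarith) hr u)]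

lemma hasDerivAt_log_gammaPDFReal (hα : 0 < α) (hr : 0 < r) {u : ℝ} (hu : 0 < u) :
    HasDerivAt (fun u => Real.log (gammaPDFReal α r u)) ((α - 1) / u - r) u := by
  have hΓ := Real.Gamma_pos_of_pos hα
  have h1 : (fun u => Real.log (gammaPDFReal α r u)) =ᶠ[𝓝 u] fun u =>
      Real.log (r ^ α / Real.Gamma α) + (α - 1) * Real.log u - r * u := by
    filter_upwards [Ioi_mem_nhds hu] with v hv
    have hv : 0 < v := hv
    rw [gammaPDFReal, if_pos hv.le, Real.log_mul (by positivity) (by positivity),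
      Real.log_mul (by positivity) (by positivity), Real.log_exp, Real.log_rpow hv]
    ring
  have h2 := (((Real.hasDerivAt_log hu.ne').const_mul (α - 1)).const_add
    (Real.log (r ^ α / Real.Gamma α))).sub ((hasDerivAt_id u).const_mul r)
  refine (h2.congr_of_eventuallyEq h1).congr_deriv ?_
  ring

lemma hasDerivAt_gammaPDFReal (hα : 0 < α) (hr : 0 < r) {u : ℝ} (hu : 0 < u) :
    HasDerivAt (gammaPDFReal α r) (gammaPDFReal α r u * ((α - 1) / u - r)) u := by
  have h1 : gammaPDFReal α r =ᶠ[𝓝 u] fun u => Real.exp (Real.log (gammaPDFReal α r u)) := by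
    filter_upwards [Ioi_mem_nhds hu] with v hv
    rw [Real.exp_log (gammaPDFReal_pos hα hr hv)]
  have h2 := (hasDerivAt_log_gammaPDFReal hα hr hu).exp
  rw [Real.exp_log (gammaPDFReal_pos hα hr hu)] at h2
  exact h2.congr_of_eventuallyEq h1

lemma isDiffDensity_relDensity [IsProbabilityMeasure μ] (hα : 1 / 2 ≤ α) (hr : 0 < r) (hτ : 0 < τ)
    (hpos : ∀ᵐ x ∂μ, 0 < x) :
    IsDiffDensity ((gammaMeasure α r).withDensity fun u => ENNReal.ofReal (relDensity α r τ μ u))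
      fun u => gammaPDFReal α r u * relDensity α r τ μ u where
  nonneg u hu := mul_nonneg (gammaPDFReal_nonneg (by linarith) hr u)
    (relDensity_pos hα hr hτ hpos hu.le).le
  differentiableOn u hu := ((hasDerivAt_gammaPDFReal (by linarith) hr hu).mul
    (hasDerivAt_relDensity hα hr hτ hpos hu)).differentiableAt.differentiableWithinAt
  eq_withDensity := relDensity_measure_eq hα hr

/-- Two densities of one finite law agree almost everywhere, and continuity promotes this to
equality on `(0, ∞)`. This makes the choice of density in `fisherInfo` immaterial. -/
lemma IsDiffDensity.eqOn {ν : Measure ℝ} [IsFiniteMeasure ν] {f g : ℝ → ℝ}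
    (hf : IsDiffDensity ν f) (hg : IsDiffDensity ν g) : EqOn f g (Ioi 0) := by
  have hfm : AEMeasurable (fun u => ENNReal.ofReal (f u)) (volume.restrict (Ioi 0)) :=
    (hf.differentiableOn.continuousOn.aemeasurable measurableSet_Ioi).ennreal_ofReal
  have hgm : AEMeasurable (fun u => ENNReal.ofReal (g u)) (volume.restrict (Ioi 0)) :=
    (hg.differentiableOn.continuousOn.aemeasurable measurableSet_Ioi).ennreal_ofReal
  have hfin : ∫⁻ u in Ioi (0 : ℝ), ENNReal.ofReal (f u) ≠ ⊤ := by
    have := measure_ne_top ν univ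
    rwa [hf.eq_withDensity, withDensity_apply _ MeasurableSet.univ, Measure.restrict_univ] at this
  have h := (withDensity_eq_iff hfm hgm hfin).1 (hf.eq_withDensity.symm.trans hg.eq_withDensity)
  refine Measure.eqOn_open_of_ae_eq (μ := volume) ?_ isOpen_Ioi hf.differentiableOn.continuousOn
    hg.differentiableOn.continuousOn
  filter_upwards [h, ae_restrict_mem measurableSet_Ioi] with u hu hu0
  exact (ENNReal.ofReal_eq_ofReal_iff (hf.nonneg u hu0) (hg.nonneg u hu0)).1 hu

lemma relDensity_measure_ae_pos (hα : 1 / 2 ≤ α) (hr : 0 < r) [SFinite μ] :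
    ∀ᵐ u ∂(gammaMeasure α r).withDensity fun u => ENNReal.ofReal (relDensity α r τ μ u), 0 < u := by
  rw [relDensity_measure_eq hα hr]
  exact (withDensity_absolutelyContinuous _ _).ae_le (ae_restrict_mem measurableSet_Ioi)

/-- The score of the path is that of the gamma law of rate `r` plus `N' / N`. Subtracting the gamma
score of rate `lam` leaves `N' / N - (r - lam)`, and `r - lam = r τ`. -/
lemma fisherInfo_eq [IsProbabilityMeasure μ] (hα : 1 / 2 ≤ α) (hr : 0 < r) (hτ : 0 < τ)
    (hlr : lam = r * (1 - τ)) (hpos : ∀ᵐ x ∂μ, 0 < x) {ν : Measure ℝ} [IsFiniteMeasure ν]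
    (hν : ν = (gammaMeasure α r).withDensity fun u => ENNReal.ofReal (relDensity α r τ μ u)) :
    fisherInfo α lam ν = ∫⁻ u, ENNReal.ofReal (relScore α r τ μ u ^ 2) ∂ν := by
  have hd : IsDiffDensity ν fun u => gammaPDFReal α r u * relDensity α r τ μ u :=
    hν ▸ isDiffDensity_relDensity hα hr hτ hpos
  have hex : ∃ f, IsDiffDensity ν f := ⟨_, hd⟩
  rw [fisherInfo, dif_pos hex]
  have heq := hex.choose_spec.eqOn hd
  have hpos' : ∀ᵐ u ∂ν, 0 < u := hν ▸ relDensity_measure_ae_pos hα hr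
  refine lintegral_congr_ae ?_
  filter_upwards [hpos'] with u hu
  have hN := relDensity_pos hα hr hτ hpos hu.le
  have h1 : (fun t => Real.log (hex.choose t)) =ᶠ[𝓝 u]
      fun t => Real.log (gammaPDFReal α r t) + Real.log (relDensity α r τ μ t) := by
    filter_upwards [Ioi_mem_nhds hu] with v hv
    rw [heq hv, Real.log_mul (gammaPDFReal_pos (by linarith) hr hv).ne'
      (relDensity_pos hα hr hτ hpos (le_of_lt hv)).ne']
  have h2 : score hex.choose u = (α - 1) / u - r + relDensityDeriv α r τ μ u / relDensity α r τ μ u := by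
    rw [score, h1.deriv_eq]
    exact ((hasDerivAt_log_gammaPDFReal (by linarith) hr hu).add
      ((hasDerivAt_relDensity hα hr hτ hpos hu).log hN.ne')).deriv
  rw [h2, gammaScore, relScore, mul_pow, Real.sq_sqrt hu.le, hlr]
  congr 2
  ring

/-- The Bessel function at `2√y` is `y ^ ((α - 1) / 2) / Γ(α)` times `₀F₁(; α; y)`, and the powers
combine with the gamma density. The result is symmetric in `u` and `x`, reflecting reversibility of
the semigroup. -/
lemma laguerreKernel_div_gammaPDFReal (hα : 1 / 2 ≤ α) (hlam : 0 < lam) (hτ0 : 0 < τ)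
    (hτ1 : τ < 1) (hr : r = lam / (1 - τ)) {u x : ℝ} (hu : 0 < u) (hx : 0 < x) :
    laguerreKernel α lam τ u x / gammaPDFReal α lam x =
      (r / lam) ^ α * Real.exp (-(r * τ * u)) *
        (Real.exp (-(r * τ * x)) * hypF α (r ^ 2 * τ * u * x)) := by
  have hα0 : 0 < α := by linarith
  have h1τ : 0 < 1 - τ := sub_pos.2 hτ1
  have hr0 : 0 < r := hr ▸ by positivity
  have hΓ := Real.Gamma_pos_of_pos hα0
  set y := r ^ 2 * τ * u * x with hy
  have hy0 : 0 < y := by positivity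
  have hz : 2 * lam * √(x * u * τ) / (1 - τ) / 2 = √y := by
    rw [hy, show r ^ 2 * τ * u * x = r ^ 2 * (x * u * τ) by ring, Real.sqrt_mul (sq_nonneg r),
      Real.sqrt_sq hr0.le, hr]
    ring
  have hB : besselI (α - 1) (2 * lam * √(x * u * τ) / (1 - τ)) =
      y ^ ((α - 1) / 2) / Real.Gamma α * hypF α y := by
    rw [besselI, hypF, ← tsum_mul_left]
    congr with n
    have h1 : √y ^ (2 * (n : ℝ) + (α - 1)) = y ^ n * y ^ ((α - 1) / 2) := by
      rw [Real.sqrt_eq_rpow, ← Real.rpow_mul hy0.le, ← Real.rpow_natCast, ← Real.rpow_add hy0]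
      congr 1
      ring
    rw [hz, h1, hypCoef, show (n : ℝ) + (α - 1) + 1 = α + n by ring]
    have := Real.Gamma_pos_of_pos (show 0 < α + n by positivity)
    field_simp
  have hrp : (x / (τ * u)) ^ ((α - 1) / 2) * y ^ ((α - 1) / 2) = r ^ (α - 1) * x ^ (α - 1) := by
    rw [← Real.mul_rpow (by positivity) hy0.le, ← Real.mul_rpow hr0.le hx.le,
      show x / (τ * u) * y = (r * x) ^ (2 : ℝ) by rw [hy, Real.rpow_two]; field_simp,
      ← Real.rpow_mul (by positivity)]
    congr 1
    ring
  have hra : r ^ α = r * r ^ (α - 1) := by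
    rw [Real.rpow_sub_one hr0.ne']; field_simp
  have he : Real.exp (-(lam * x / (1 - τ))) * Real.exp (-(lam * τ * u / (1 - τ))) =
      Real.exp (-(r * τ * u)) * Real.exp (-(r * τ * x)) * Real.exp (-(lam * x)) := by
    rw [← Real.exp_add, ← Real.exp_add, ← Real.exp_add, hr]
    congr 1
    field_simp
    ring
  have hlα := Real.rpow_pos_of_pos hlam α
  have hxα := Real.rpow_pos_of_pos hx (α - 1)
  rw [laguerreKernel, hB, gammaPDFReal, if_pos hx.le, Real.div_rpow hr0.le hlam.le, hra, ← hr]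
  rw [show ∀ A B C D E F G : ℝ, A * B * C * D * (E / F * G) = A * (B * E) * (C * D) / F * G by
    intros; ring, hrp, he]
  field_simp

lemma logRatio_eq (hα : 1 / 2 ≤ α) (hlam : 0 < lam) (hτ0 : 0 < τ)
    (hτ1 : τ < 1) (hr : r = lam / (1 - τ)) {f : ℝ → ℝ} (hf : Measurable f)
    (hf0 : ∀ x, 0 < x → 0 ≤ f x)
    (hμ : μ = (volume.restrict (Ioi 0)).withDensity fun x => ENNReal.ofReal (f x))
    {u : ℝ} (hu : 0 < u) :
    logRatio α lam τ f u =
      Real.log ((r / lam) ^ α * Real.exp (-(r * τ * u)) * relDensity α r τ μ u) := by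
  rw [logRatio, laguerreSemigroup, relDensity, hμ,
    integral_withDensity_eq_integral_toReal_smul (by fun_prop) (by simp), ← integral_const_mul]
  congr 1
  refine setIntegral_congr_fun measurableSet_Ioi fun x hx => ?_
  have h := laguerreKernel_div_gammaPDFReal hα hlam hτ0 hτ1 hr hu hx
  rw [ENNReal.toReal_ofReal (hf0 x hx), smul_eq_mul]
  rw [div_mul_eq_mul_div, mul_div_assoc, h]
  ring

lemma dSigma_logRatio (hα : 1 / 2 ≤ α) (hlam : 0 < lam) (hτ0 : 0 < τ)
    (hτ1 : τ < 1) (hr : r = lam / (1 - τ)) {f : ℝ → ℝ} (hf : Measurable f)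
    (hf0 : ∀ x, 0 < x → 0 ≤ f x) [IsProbabilityMeasure μ] (hpos : ∀ᵐ x ∂μ, 0 < x)
    (hμ : μ = (volume.restrict (Ioi 0)).withDensity fun x => ENNReal.ofReal (f x))
    {u : ℝ} (hu : 0 < u) : dSigma (logRatio α lam τ f) u = relScore α r τ μ u := by
  have h1τ : 0 < 1 - τ := sub_pos.2 hτ1
  have hr0 : 0 < r := hr ▸ by positivity
  have hN := relDensity_pos hα hr0 hτ0 hpos hu.le
  have h1 : logRatio α lam τ f =ᶠ[𝓝 u] fun t =>
      Real.log ((r / lam) ^ α) + -(r * τ * t) + Real.log (relDensity α r τ μ t) := by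
    filter_upwards [Ioi_mem_nhds hu] with v hv
    rw [logRatio_eq hα hlam hτ0 hτ1 hr hf hf0 hμ hv,
      Real.log_mul (by positivity) (relDensity_pos hα hr0 hτ0 hpos (le_of_lt hv)).ne',
      Real.log_mul (by positivity) (by positivity), Real.log_exp]
  have h2 := ((((hasDerivAt_id u).const_mul (r * τ)).neg).const_add (Real.log ((r / lam) ^ α))).add
    ((hasDerivAt_relDensity hα hr0 hτ0 hpos hu).log hN.ne')
  rw [dSigma, h1.deriv_eq, relScore]
  congr 1
  refine h2.deriv.trans ?_
  ring

end

/-! ### Integrability and the truncated representation formula -/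

section

variable {α lam r τ : ℝ} {μ : Measure ℝ}

lemma abs_ratioV_le_one (hτ1 : τ < 1) {g : ℝ} (hg : 0 ≤ g) (x z : ℝ) :
    |ratioV lam τ x z g| ≤ 1 := by
  have h1τ : 0 ≤ 1 - τ := by linarith
  rw [ratioV, abs_div, abs_of_nonneg (Real.sqrt_nonneg _)]
  refine div_le_one_of_le₀ ?_ (Real.sqrt_nonneg _)
  refine Real.abs_le_sqrt ?_
  rw [pathPoint]
  have : 0 ≤ (1 - τ) * g := by positivity
  linarith

lemma measurable_ratioV (lam τ : ℝ) :
    Measurable fun p : ℝ × ℝ × ℝ => ratioV lam τ p.1 p.2.1 p.2.2 := by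
  have := measurable_pathPoint lam τ
  unfold ratioV
  refine Measurable.div ?_ (by fun_prop)
  unfold shiftedGaussian
  fun_prop

/-- The joint law of `X`, `Z`, `G`. -/
noncomputable def jointLaw (α lam : ℝ) (μ : Measure ℝ) : Measure (ℝ × ℝ × ℝ) :=
  μ.prod ((gaussianReal 0 1).prod (gammaLaw (α - 1 / 2) lam))

lemma integrable_id_gaussianReal : Integrable (fun z : ℝ => z) (gaussianReal 0 1) :=
  (memLp_id_gaussianReal' 1 ENNReal.one_ne_top).integrable le_rfl

lemma integrable_sq_gaussianReal : Integrable (fun z : ℝ => z ^ 2) (gaussianReal 0 1) :=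
  (memLp_id_gaussianReal' 2 ENNReal.ofNat_ne_top).integrable_sq

lemma integrable_id_gammaLaw {a r : ℝ} (ha : 0 ≤ a) (hr : 0 < r) :
    Integrable (fun g : ℝ => g) (gammaLaw a r) := by
  have h1 : Integrable (fun g => Real.exp (r / 2 * g)) (gammaLaw a r) := by
    refine integrable_exp_of_lintegral ?_
    rw [lintegral_exp_gammaLaw ha hr (by linarith)]
    exact ENNReal.ofReal_ne_top
  refine (h1.const_mul (2 / r)).mono' measurable_id.aestronglyMeasurable ?_
  filter_upwards [gammaLaw_ae_nonneg a r] with g hg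
  rw [Real.norm_of_nonneg hg]
  have h2 := Real.add_one_le_exp (r / 2 * g)
  rw [div_mul_eq_mul_div, le_div_iff₀ hr]
  linarith

lemma integrable_gaussian_prod_gamma (hα : 1 / 2 ≤ α) (hlam : 0 < lam) (s : ℝ) :
    Integrable (fun p : ℝ × ℝ => |p.1| * (2 + p.2 + s * |p.1|))
      ((gaussianReal 0 1).prod (gammaLaw (α - 1 / 2) lam)) := by
  have hα' : 0 ≤ α - 1 / 2 := by linarith
  have := isProbabilityMeasure_gammaLaw hα' hlam
  have i1 : Integrable (fun z : ℝ => 2 * |z| + s * z ^ 2) (gaussianReal 0 1) :=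
    (integrable_id_gaussianReal.abs.const_mul 2).add (integrable_sq_gaussianReal.const_mul s)
  have i2 := integrable_id_gaussianReal.abs.mul_prod (integrable_id_gammaLaw hα' hlam)
  refine ((i1.comp_fst _).add i2).congr (ae_of_all _ fun p => ?_)
  simp only [Pi.add_apply]
  rw [← sq_abs]
  ring

lemma jointLaw_ae [SFinite μ] (hα : 1 / 2 ≤ α) (hlam : 0 < lam) (hpos : ∀ᵐ x ∂μ, 0 < x) :
    ∀ᵐ p ∂jointLaw α lam μ, 0 < p.1 ∧ 0 ≤ p.2.2 := by
  have := isProbabilityMeasure_gammaLaw (show 0 ≤ α - 1 / 2 by linarith) hlam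
  have h1 : ∀ᵐ p ∂jointLaw α lam μ, 0 < p.1 := Measure.quasiMeasurePreserving_fst.ae hpos
  have h2 : ∀ᵐ p ∂jointLaw α lam μ, 0 ≤ p.2.2 :=
    Measure.quasiMeasurePreserving_snd.ae
      (Measure.quasiMeasurePreserving_snd.ae (gammaLaw_ae_nonneg (α - 1 / 2) lam))
  exact h1.and h2

lemma sqrt_pathPoint_le (hτ0 : 0 < τ) (hτ1 : τ < 1) {x g : ℝ}
    (hg : 0 ≤ g) (z : ℝ) :
    √(pathPoint lam τ x z g) ≤ 1 + g + √x + √((1 - τ) / (2 * lam)) * |z| := by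
  have h1τ : 0 < 1 - τ := sub_pos.2 hτ1
  have h1 : |shiftedGaussian lam τ x z| ≤ √x + √((1 - τ) / (2 * lam)) * |z| := by
    refine (abs_add_le _ _).trans ?_
    rw [abs_mul, abs_mul, abs_of_nonneg (Real.sqrt_nonneg _), abs_of_nonneg (Real.sqrt_nonneg _),
      abs_of_nonneg (Real.sqrt_nonneg _)]
    gcongr
    exact mul_le_of_le_one_left (Real.sqrt_nonneg _) (Real.sqrt_le_one.2 hτ1.le)
  have h2 : √(pathPoint lam τ x z g) ≤ 1 + g + |shiftedGaussian lam τ x z| := by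
    refine Real.sqrt_le_iff.2 ⟨by positivity, ?_⟩
    rw [pathPoint, ← sq_abs (shiftedGaussian lam τ x z)]
    have := abs_nonneg (shiftedGaussian lam τ x z)
    nlinarith [mul_nonneg hg this]
  linarith

lemma integrable_pathPoint [IsProbabilityMeasure μ] (hα : 1 / 2 ≤ α) (hlam : 0 < lam)
    (hτ0 : 0 < τ) (hτ1 : τ < 1) (hpos : ∀ᵐ x ∂μ, 0 < x) (hid : Integrable (fun x => x) μ) :
    Integrable (fun p => pathPoint lam τ p.1 p.2.1 p.2.2) (jointLaw α lam μ) := by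
  have h1τ : 0 < 1 - τ := sub_pos.2 hτ1
  have hα' : 0 ≤ α - 1 / 2 := by linarith
  have := isProbabilityMeasure_gammaLaw hα' hlam
  have i1 : Integrable (fun p : ℝ × ℝ × ℝ => p.2.2) (jointLaw α lam μ) :=
    ((integrable_id_gammaLaw hα' hlam).comp_snd (gaussianReal 0 1)).comp_snd μ
  have i2 : Integrable (fun p : ℝ × ℝ × ℝ => p.2.1 ^ 2) (jointLaw α lam μ) :=
    (integrable_sq_gaussianReal.comp_fst (gammaLaw (α - 1 / 2) lam)).comp_snd μ
  have i3 : Integrable (fun p : ℝ × ℝ × ℝ => p.1) (jointLaw α lam μ) := hid.comp_fst _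
  refine (((i1.const_mul (1 - τ)).add (i3.const_mul (2 * τ))).add
    (i2.const_mul (2 * ((1 - τ) / (2 * lam))))).mono'
    (measurable_pathPoint lam τ).aestronglyMeasurable ?_
  filter_upwards [jointLaw_ae hα hlam hpos] with p hp
  have h0 : 0 ≤ (1 - τ) * p.2.2 := mul_nonneg h1τ.le hp.2
  rw [Real.norm_of_nonneg (by rw [pathPoint]; positivity), pathPoint, shiftedGaussian]
  have h1 : (√τ * √p.1) ^ 2 = τ * p.1 := by
    rw [mul_pow, Real.sq_sqrt hτ0.le, Real.sq_sqrt hp.1.le]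
  have h2 : (√((1 - τ) / (2 * lam)) * p.2.1) ^ 2 = (1 - τ) / (2 * lam) * p.2.1 ^ 2 := by
    rw [mul_pow, Real.sq_sqrt (by positivity)]
  simp only [Pi.add_apply]
  nlinarith [sq_nonneg (√τ * √p.1 - √((1 - τ) / (2 * lam)) * p.2.1)]

/-- The Stein integrand, in terms of `relScore`. -/
noncomputable def relIntegrand (α lam r τ : ℝ) (μ : Measure ℝ) (T : ℝ → ℝ) (p : ℝ × ℝ × ℝ) : ℝ :=
  (T p.1 - 1) * p.2.1 * ratioV lam τ p.1 p.2.1 p.2.2 *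
    relScore α r τ μ (pathPoint lam τ p.1 p.2.1 p.2.2)

lemma aestronglyMeasurable_relIntegrand [IsProbabilityMeasure μ] (hα : 1 / 2 ≤ α) (hlam : 0 < lam)
    (r τ : ℝ) {T : ℝ → ℝ} (hT : AEStronglyMeasurable T μ) :
    AEStronglyMeasurable (relIntegrand α lam r τ μ T) (jointLaw α lam μ) := by
  have := isProbabilityMeasure_gammaLaw (show 0 ≤ α - 1 / 2 by linarith) hlam
  have h1 : AEStronglyMeasurable (fun p : ℝ × ℝ × ℝ => T p.1 - 1) (jointLaw α lam μ) :=
    (hT.sub aestronglyMeasurable_const).comp_fst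
  have h2 := (measurable_relScore (μ := μ) hα r τ).comp (measurable_pathPoint lam τ)
  exact ((h1.mul (Measurable.aestronglyMeasurable (by fun_prop))).mul
    (measurable_ratioV lam τ).aestronglyMeasurable).mul h2.aestronglyMeasurable

/-- As `|𝒱| ≤ 1` and the score is `O(1 + √X_τ)`, the integrand is dominated by `(|T(X)| + 1) |Z| (2
+ G + √X + s |Z|)` up to a constant. By independence only `E[√X |T(X)|]` is needed beyond the
standing moments. -/
lemma integrable_relIntegrand [IsProbabilityMeasure μ] (hα : 1 / 2 ≤ α) (hlam : 0 < lam)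
    (hr : 0 < r) (hτ0 : 0 < τ) (hτ1 : τ < 1) (hpos : ∀ᵐ x ∂μ, 0 < x)
    (hid : Integrable (fun x => x) μ) {T : ℝ → ℝ} (hT : Integrable T μ)
    (hTs : Integrable (fun x => √x * T x) μ) :
    Integrable (relIntegrand α lam r τ μ T) (jointLaw α lam μ) := by
  have h1τ : 0 < 1 - τ := sub_pos.2 hτ1
  have := isProbabilityMeasure_gammaLaw (show 0 ≤ α - 1 / 2 by linarith) hlam
  obtain ⟨C, hC0, hC⟩ := exists_abs_relScore_le hα hr hτ0 hpos
  set s := √((1 - τ) / (2 * lam)) with hs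
  have hsq : Integrable (fun x => √x) μ := by
    refine ((integrable_const 1).add hid).mono' (by fun_prop) ?_
    filter_upwards [hpos] with x hx
    rw [Real.norm_of_nonneg (Real.sqrt_nonneg _)]
    simp only [Pi.add_apply]
    nlinarith [Real.sq_sqrt hx.le, sq_nonneg (√x - 1)]
  have i1 : Integrable (fun x => |T x| + 1) μ := hT.abs.add (integrable_const 1)
  have i2 : Integrable (fun x => (|T x| + 1) * √x) μ := by
    refine (hTs.abs.add hsq).congr (ae_of_all _ fun x => ?_)
    simp only [Pi.add_apply, abs_mul, abs_of_nonneg (Real.sqrt_nonneg x)]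
    ring
  have i3 := i1.mul_prod (integrable_gaussian_prod_gamma hα hlam s)
  have i4 := i2.mul_prod (integrable_id_gaussianReal.abs.comp_fst (gammaLaw (α - 1 / 2) lam))
  refine ((i3.add i4).const_mul C).mono'
    (aestronglyMeasurable_relIntegrand hα hlam r τ hT.aestronglyMeasurable) ?_
  filter_upwards [jointLaw_ae hα hlam hpos] with p hp
  have hV := abs_ratioV_le_one (lam := lam) hτ1 hp.2 p.1 p.2.1
  have hS0 : 0 ≤ pathPoint lam τ p.1 p.2.1 p.2.2 := by
    have := hp.2
    unfold pathPoint
    positivity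
  have hS := hC _ hS0
  have hS1 := sqrt_pathPoint_le (lam := lam) hτ0 hτ1 (x := p.1) hp.2 p.2.1
  have hTb : |T p.1 - 1| ≤ |T p.1| + 1 := (abs_sub _ _).trans (by simp)
  rw [relIntegrand, norm_mul, norm_mul, norm_mul, Real.norm_eq_abs, Real.norm_eq_abs,
    Real.norm_eq_abs, Real.norm_eq_abs]
  simp only [Pi.add_apply]
  calc _ ≤ (|T p.1| + 1) * |p.2.1| * 1 * (C * (1 + (1 + p.2.2 + √p.1 + s * |p.2.1|))) := by
        gcongr
        refine hS.trans ?_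
        gcongr
    _ = _ := by ring

/-- The representation formula, truncated to a compact set of values of the path. -/
lemma integral_relIntegrand_indicator [IsProbabilityMeasure μ] (hα : 1 / 2 ≤ α) (hlam : 0 < lam)
    (hτ0 : 0 < τ) (hτ1 : τ < 1) (hr : r = lam / (1 - τ)) {T : ℝ → ℝ}
    (hT : IsSteinKernel α lam μ T) (hpos : ∀ᵐ x ∂μ, 0 < x) {m : ℝ} (hm : 0 < m) :
    ∫ p, relIntegrand α lam r τ μ T p *
        (Icc (1 / m) m).indicator 1 (pathPoint lam τ p.1 p.2.1 p.2.2) ∂jointLaw α lam μ =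
      2 * √((1 - τ) / (2 * lam)) / τ * ∫ u, relScore α r τ μ u ^ 2 * (Icc (1 / m) m).indicator 1 u
        ∂(gammaMeasure α r).withDensity fun u => ENNReal.ofReal (relDensity α r τ μ u) := by
  have hα0 : 0 < α := by linarith
  have hα1 : 1 / 2 ≤ α + 1 := by linarith
  have h1τ : 0 < 1 - τ := sub_pos.2 hτ1
  have hr0 : 0 < r := hr ▸ by positivity
  have hlr : lam = r * (1 - τ) := by rw [hr]; field_simp
  have := isProbabilityMeasure_gammaLaw (show 0 ≤ α - 1 / 2 by linarith) hlam
  have := isProbabilityMeasure_gammaMeasure hα0 hr0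
  have hTi := hT.integrable
  obtain ⟨C, hC0, hC⟩ := exists_abs_relScore_le hα hr0 hτ0 hpos
  set s := √((1 - τ) / (2 * lam)) with hs
  set I : ℝ → ℝ := (Icc (1 / m) m).indicator 1 with hI
  have hIm : Measurable I := measurable_one.indicator measurableSet_Icc
  have hI1 : ∀ u, u ∈ Icc (1 / m) m → I u = 1 := fun u hu => indicator_of_mem hu _
  have hI0 : ∀ u, u ∉ Icc (1 / m) m → I u = 0 := fun u hu => indicator_of_notMem hu _
  have hIpos : ∀ u ∈ Icc (1 / m) m, 0 < u := fun u hu => lt_of_lt_of_le (by positivity) hu.1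
  -- The division by `√u` is the denominator of `𝒱`. Truncation away from `0` and infinity makes `k`
  -- bounded, as the Gaussian weight formula requires.
  set k : ℝ → ℝ := fun u => relScore α r τ μ u * I u / √u with hk
  have hkm : Measurable k := by
    have := measurable_relScore (μ := μ) hα r τ
    fun_prop
  have hscore : ∀ u, |relScore α r τ μ u * I u| ≤ C * (1 + √m) := by
    intro u
    by_cases hu : u ∈ Icc (1 / m) m
    · rw [hI1 u hu, mul_one]
      refine (hC u (hIpos u hu).le).trans ?_
      gcongr
      exact hu.2
    · rw [hI0 u hu, mul_zero, abs_zero]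
      positivity
  have hk0 : ∀ u, u ∉ Icc (1 / m) m → k u = 0 := fun u hu => by
    simp only [hk, hI0 u hu, mul_zero, zero_div]
  have hkb : ∀ u, |k u| ≤ C * (1 + √m) / √(1 / m) := by
    intro u
    by_cases hu : u ∈ Icc (1 / m) m
    · rw [hk, abs_div, abs_of_nonneg (Real.sqrt_nonneg u)]
      have : 0 < √(1 / m) := Real.sqrt_pos.2 (by positivity)
      have h2 : √(1 / m) ≤ √u := Real.sqrt_le_sqrt hu.1
      exact div_le_div₀ (by positivity) (hscore u) this h2
    · rw [hk0 u hu, abs_zero]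
      positivity
  have hpt : ∀ p : ℝ × ℝ × ℝ,
      relIntegrand α lam r τ μ T p * I (pathPoint lam τ p.1 p.2.1 p.2.2) =
      (T p.1 - 1) * s * (k ((p.2.1 + √(2 * r * τ * p.1)) ^ 2 / (2 * r) + (1 - τ) * p.2.2) *
        (p.2.1 * (p.2.1 + √(2 * r * τ * p.1)))) := by
    intro p
    rw [relIntegrand, ratioV, shiftedGaussian_eq hlam hτ0 hτ1 hr,
      ← pathPoint_eq hlam hτ0 hτ1 hr]
    simp only [hk]
    ring
  have hint : Integrable (fun p => relIntegrand α lam r τ μ T p *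
      I (pathPoint lam τ p.1 p.2.1 p.2.2)) (jointLaw α lam μ) := by
    have i1 : Integrable (fun x => |T x - 1|) μ := (hTi.sub (integrable_const 1)).abs
    have i2 := (i1.mul_prod (integrable_id_gaussianReal.abs.comp_fst
      (gammaLaw (α - 1 / 2) lam))).mul_const (C * (1 + √m))
    refine i2.mono' ((aestronglyMeasurable_relIntegrand hα hlam r τ
      hTi.aestronglyMeasurable).mul
      (hIm.comp (measurable_pathPoint lam τ)).aestronglyMeasurable) ?_
    filter_upwards [jointLaw_ae hα hlam hpos] with p hp
    have hV := abs_ratioV_le_one (lam := lam) hτ1 hp.2 p.1 p.2.1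
    rw [relIntegrand, mul_assoc, norm_mul, norm_mul, norm_mul, Real.norm_eq_abs, Real.norm_eq_abs,
      Real.norm_eq_abs, Real.norm_eq_abs]
    calc _ ≤ |T p.1 - 1| * |p.2.1| * 1 * (C * (1 + √m)) := by
          gcongr
          exact hscore _
      _ = _ := by ring
  have hinner : ∀ x, 0 < x → ∫ p : ℝ × ℝ, (T x - 1) * s *
      (k ((p.1 + √(2 * r * τ * x)) ^ 2 / (2 * r) + (1 - τ) * p.2) *
        (p.1 * (p.1 + √(2 * r * τ * x)))) ∂(gaussianReal 0 1).prod (gammaLaw (α - 1 / 2) lam) =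
      ∫ u, s * r * (k u * u) * ((T x - 1) * (Real.exp (-(r * τ * x)) *
        (2 * hypF α (r ^ 2 * τ * u * x) + (1 - 2 * α - 2 * (r * τ * x)) *
          (hypF (α + 1) (r ^ 2 * τ * u * x) / α)))) ∂gammaMeasure α r := by
    intro x hx
    have h := integral_gaussian_weight hα hr0 h1τ (b := √(2 * r * τ * x))
      (Real.sqrt_pos.2 (by positivity)) hkm hkb
    rw [← hlr, Real.sq_sqrt (by positivity)] at h
    rw [integral_const_mul, h, ← mul_assoc, ← integral_const_mul]
    congr with u
    rw [show 2 * r * τ * x / 2 = r * τ * x by ring,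
      show r * (r * τ * x) * u = r ^ 2 * τ * u * x by ring]
    ring
  -- Fubini's hypothesis: for `u` in `[1/m, m]` the decay `e^{-rτx}` beats the growth `exp (2 √(c
  -- x))` of `₀F₁`, with `c = r²τm`, so the function is at most a constant times `|T(x) - 1|`. The
  -- constants `E0`, `E1` are the maxima of the exponents without and with an additional factor `exp
  -- √x`, which bounds `x / 2`.
  have hswap : Integrable (fun q : ℝ × ℝ => s * r * (k q.2 * q.2) * ((T q.1 - 1) *
      (Real.exp (-(r * τ * q.1)) * (2 * hypF α (r ^ 2 * τ * q.2 * q.1) +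
        (1 - 2 * α - 2 * (r * τ * q.1)) * (hypF (α + 1) (r ^ 2 * τ * q.2 * q.1) / α)))))
      (μ.prod (gammaMeasure α r)) := by
    set c := r ^ 2 * τ * m with hc
    have hc0 : 0 < c := by positivity
    set D := C * (1 + √m) / √(1 / m) with hD
    have hD0 : 0 ≤ D := (abs_nonneg _).trans (hkb 0)
    set E0 := Real.exp ((2 * √c) ^ 2 / (4 * (r * τ))) with hE0
    set E1 := Real.exp ((2 * √c + 1) ^ 2 / (4 * (r * τ))) with hE1
    have i1 : Integrable (fun x => |T x - 1|) μ := (hTi.sub (integrable_const 1)).abs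
    have i2 := (i1.comp_fst (gammaMeasure α r)).const_mul (s * r * (D * m) *
      (2 * E0 + ((1 + 2 * α) * E0 + 2 * r * τ * (2 * E1)) / α))
    have hF0 := continuous_hypF hα
    have hF1 := continuous_hypF hα1
    have hTm : AEStronglyMeasurable (fun q : ℝ × ℝ => T q.1 - 1) (μ.prod (gammaMeasure α r)) :=
      (hTi.sub (integrable_const 1)).aestronglyMeasurable.comp_fst
    refine i2.mono' ?_ ?_
    · refine AEStronglyMeasurable.mul (Measurable.aestronglyMeasurable (by fun_prop))
        (hTm.mul (Continuous.aestronglyMeasurable (by fun_prop)))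
    · have hq1 : ∀ᵐ q ∂μ.prod (gammaMeasure α r), 0 < q.1 :=
        Measure.quasiMeasurePreserving_fst.ae hpos
      filter_upwards [hq1] with q hx
      obtain ⟨x, u⟩ := q
      dsimp only at hx ⊢
      have hs0 : 0 ≤ s := Real.sqrt_nonneg _
      have hα' : 0 ≤ 1 + 2 * α := by linarith
      by_cases hu : u ∈ Icc (1 / m) m
      · have hu0 := hIpos u hu
        have hle : r ^ 2 * τ * u * x ≤ c * x := by rw [hc]; gcongr; exact hu.2
        have hexp : ∀ a, 1 / 2 ≤ a → hypF a (r ^ 2 * τ * u * x) ≤ Real.exp (2 * √c * √x) := by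
          intro a ha
          refine (hypF_le_exp ha (by positivity)).trans (Real.exp_le_exp.2 ?_)
          rw [mul_assoc 2 (√c), ← Real.sqrt_mul hc0.le]
          gcongr
        have b0 : ∀ a, 1 / 2 ≤ a → Real.exp (-(r * τ * x)) * hypF a (r ^ 2 * τ * u * x) ≤ E0 :=
          fun a ha => le_trans (by gcongr; exact hexp a ha)
            (exp_neg_mul_exp_sqrt_le (mul_pos hr0 hτ0) (2 * √c) hx.le)
        have b1 : x * (Real.exp (-(r * τ * x)) * hypF (α + 1) (r ^ 2 * τ * u * x)) ≤ 2 * E1 := by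
          have hp := hypF_pos hα1 (show 0 ≤ r ^ 2 * τ * u * x by positivity)
          calc _ ≤ (2 * Real.exp √x) * (Real.exp (-(r * τ * x)) * Real.exp (2 * √c * √x)) := by
                gcongr
                · exact le_two_mul_exp_sqrt hx.le
                · exact hexp _ hα1
            _ = 2 * (Real.exp (-(r * τ * x)) * Real.exp ((2 * √c + 1) * √x)) := by
                rw [add_mul, one_mul, Real.exp_add]; ring
            _ ≤ 2 * E1 := by
                gcongr
                exact exp_neg_mul_exp_sqrt_le (mul_pos hr0 hτ0) (2 * √c + 1) hx.le
        have p0 := hypF_pos hα (show 0 ≤ r ^ 2 * τ * u * x by positivity)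
        have p1 := hypF_pos hα1 (show 0 ≤ r ^ 2 * τ * u * x by positivity)
        have hB : ‖Real.exp (-(r * τ * x)) * (2 * hypF α (r ^ 2 * τ * u * x) +
            (1 - 2 * α - 2 * (r * τ * x)) * (hypF (α + 1) (r ^ 2 * τ * u * x) / α))‖ ≤
            2 * E0 + ((1 + 2 * α) * E0 + 2 * r * τ * (2 * E1)) / α := by
          rw [norm_mul, Real.norm_of_nonneg (Real.exp_pos _).le]
          have t1 : ‖2 * hypF α (r ^ 2 * τ * u * x) +
              (1 - 2 * α - 2 * (r * τ * x)) * (hypF (α + 1) (r ^ 2 * τ * u * x) / α)‖ ≤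
              2 * hypF α (r ^ 2 * τ * u * x) +
              (1 + 2 * α + 2 * (r * τ * x)) * (hypF (α + 1) (r ^ 2 * τ * u * x) / α) := by
            refine (norm_add_le _ _).trans (add_le_add ?_ ?_)
            · rw [Real.norm_of_nonneg (by positivity)]
            · rw [norm_mul, Real.norm_of_nonneg (by positivity : 0 ≤ hypF (α + 1) _ / α)]
              gcongr
              have : 0 ≤ r * τ * x := by positivity
              rw [Real.norm_eq_abs, abs_le]
              constructor <;> linarith
          calc _ ≤ Real.exp (-(r * τ * x)) * (2 * hypF α (r ^ 2 * τ * u * x) +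
              (1 + 2 * α + 2 * (r * τ * x)) * (hypF (α + 1) (r ^ 2 * τ * u * x) / α)) := by gcongr
            _ = 2 * (Real.exp (-(r * τ * x)) * hypF α (r ^ 2 * τ * u * x)) +
              ((1 + 2 * α) * (Real.exp (-(r * τ * x)) * hypF (α + 1) (r ^ 2 * τ * u * x)) +
              2 * r * τ * (x * (Real.exp (-(r * τ * x)) * hypF (α + 1) (r ^ 2 * τ * u * x)))) / α := by
                ring
            _ ≤ _ := by
                gcongr
                · exact b0 _ hα
                · exact b0 _ hα1
        rw [norm_mul, norm_mul, norm_mul, norm_mul (k u), norm_mul (T x - 1),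
          Real.norm_of_nonneg hs0, Real.norm_of_nonneg hr0.le, Real.norm_of_nonneg hu0.le,
          Real.norm_eq_abs (k u), Real.norm_eq_abs (T x - 1)]
        calc _ ≤ s * r * (D * m) * (|T x - 1| *
              (2 * E0 + ((1 + 2 * α) * E0 + 2 * r * τ * (2 * E1)) / α)) := by
              gcongr
              · exact hkb u
              · exact hu.2
          _ = _ := by ring
      · rw [hk0 u hu]
        simp only [zero_mul, mul_zero, norm_zero]
        positivity
  have hN := measurable_relDensity (μ := μ) hα r τ
  -- The integral in `x` at fixed `u` is where the Stein kernel enters: it produces `N' - rτ N`,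
  -- that is, the score times `N / √u`. The other factor `√u` times the score comes from `k(u) u`.
  have houter : ∀ u, ∫ x, s * r * (k u * u) * ((T x - 1) * (Real.exp (-(r * τ * x)) *
        (2 * hypF α (r ^ 2 * τ * u * x) + (1 - 2 * α - 2 * (r * τ * x)) *
          (hypF (α + 1) (r ^ 2 * τ * u * x) / α)))) ∂μ =
      2 * s / τ * (relDensity α r τ μ u * (relScore α r τ μ u ^ 2 * I u)) := by
    intro u
    by_cases hu : u ∈ Icc (1 / m) m
    · have hu0 := hIpos u hu
      have hNp := relDensity_pos hα hr0 hτ0 hpos hu0.le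
      rw [integral_const_mul, integral_stein_kernel hα hlam hτ0 hr0 hlr hT hpos hu0]
      have e : √u * (relDensityDeriv α r τ μ u - r * τ * relDensity α r τ μ u) =
          relDensity α r τ μ u * relScore α r τ μ u := by
        rw [relScore]; field_simp
      have e2 : k u * u = relScore α r τ μ u * √u := by
        have hsu := Real.sqrt_pos.2 hu0
        have := Real.mul_self_sqrt hu0.le
        simp only [hk, hI1 u hu]
        rw [mul_one, div_mul_eq_mul_div, div_eq_iff hsu.ne', mul_assoc, this]
      rw [e2, hI1 u hu, mul_one]
      calc _ = 2 * s / τ * (relScore α r τ μ u *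
            (√u * (relDensityDeriv α r τ μ u - r * τ * relDensity α r τ μ u))) := by field_simp
        _ = _ := by rw [e]; ring
    · rw [hk0 u hu, hI0 u hu]
      simp
  rw [integral_withDensity_eq_integral_toReal_smul (by fun_prop) (by simp), jointLaw,
    integral_prod _ hint, ← integral_const_mul]
  have h1 : ∀ᵐ x ∂μ, (∫ q : ℝ × ℝ, relIntegrand α lam r τ μ T (x, q) *
      I (pathPoint lam τ x q.1 q.2) ∂(gaussianReal 0 1).prod (gammaLaw (α - 1 / 2) lam)) =
      ∫ u, s * r * (k u * u) * ((T x - 1) * (Real.exp (-(r * τ * x)) *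
        (2 * hypF α (r ^ 2 * τ * u * x) + (1 - 2 * α - 2 * (r * τ * x)) *
          (hypF (α + 1) (r ^ 2 * τ * u * x) / α)))) ∂gammaMeasure α r := by
    filter_upwards [hpos] with x hx
    rw [← hinner x hx]
    exact integral_congr_ae (ae_of_all _ fun q => hpt (x, q))
  rw [integral_congr_ae h1, integral_integral_swap hswap]
  refine integral_congr_ae ?_
  filter_upwards [gammaMeasure_ae_nonneg hα0 r] with u hu
  rw [houter u, ENNReal.toReal_ofReal (relDensity_pos hα hr0 hτ0 hpos hu).le, smul_eq_mul]

end

/-! ### Removing the truncation -/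

section

variable {α lam r τ : ℝ} {μ : Measure ℝ}

lemma tendsto_indicator_Icc {u : ℝ} (hu : 0 < u) (c : ℝ) :
    Tendsto (fun n : ℕ => c * (Icc (1 / ((n : ℝ) + 1)) (n + 1)).indicator 1 u) atTop (𝓝 c) := by
  have h1 : ∀ᶠ n : ℕ in atTop, 1 / u < (n : ℝ) + 1 :=
    (tendsto_natCast_atTop_atTop.atTop_add tendsto_const_nhds).eventually_gt_atTop _
  have h2 : ∀ᶠ n : ℕ in atTop, u < (n : ℝ) + 1 :=
    (tendsto_natCast_atTop_atTop.atTop_add tendsto_const_nhds).eventually_gt_atTop _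
  refine tendsto_const_nhds.congr' ?_
  filter_upwards [h1, h2] with n h1 h2
  have hn : (0 : ℝ) < n + 1 := by positivity
  rw [indicator_of_mem, Pi.one_apply, mul_one]
  refine ⟨?_, h2.le⟩
  rw [div_lt_iff₀ hu] at h1
  rw [div_le_iff₀ hn]
  linarith

lemma tendsto_integral_mul_indicator {E : Type*} [MeasurableSpace E] {κ : Measure E} {F S : E → ℝ}
    (hF : Integrable F κ) (hS : AEMeasurable S κ) (hpos : ∀ᵐ e ∂κ, 0 < S e) :
    Tendsto (fun n : ℕ => ∫ e, F e * (Icc (1 / ((n : ℝ) + 1)) (n + 1)).indicator 1 (S e) ∂κ) atTop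
      (𝓝 (∫ e, F e ∂κ)) := by
  refine tendsto_integral_of_dominated_convergence (fun e => ‖F e‖) (fun n => ?_) hF.norm
    (fun n => ae_of_all _ fun e => ?_) ?_
  · exact hF.aestronglyMeasurable.mul
      ((measurable_one.indicator measurableSet_Icc).comp_aemeasurable hS).aestronglyMeasurable
  · rw [norm_mul]
    refine mul_le_of_le_one_right (norm_nonneg _) ?_
    exact (norm_indicator_le_norm_self _ _).trans (by simp)
  · filter_upwards [hpos] with e he using tendsto_indicator_Icc he (F e)

/-- The square of the score is at most a constant times `1 + u`, so a first moment suffices. -/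
lemma lintegral_relScore_sq_ne_top [IsProbabilityMeasure μ] (hα : 1 / 2 ≤ α) (hr : 0 < r)
    (hτ : 0 < τ) (hpos : ∀ᵐ x ∂μ, 0 < x) {ν : Measure ℝ} [IsFiniteMeasure ν]
    (hν : ∀ᵐ u ∂ν, 0 < u) (hid : Integrable (fun u => u) ν) :
    ∫⁻ u, ENNReal.ofReal (relScore α r τ μ u ^ 2) ∂ν ≠ ⊤ := by
  obtain ⟨C, hC0, hC⟩ := exists_abs_relScore_le hα hr hτ hpos
  have hi : Integrable (fun u => C ^ 2 * (2 * (1 + u))) ν :=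
    (((integrable_const 1).add hid).const_mul 2).const_mul _
  refine ne_top_of_le_ne_top hi.lintegral_lt_top.ne (lintegral_mono_ae ?_)
  filter_upwards [hν] with u hu
  refine ENNReal.ofReal_le_ofReal ?_
  rw [← sq_abs]
  calc |relScore α r τ μ u| ^ 2 ≤ (C * (1 + √u)) ^ 2 := by gcongr; exact hC u hu.le
    _ = C ^ 2 * (1 + √u) ^ 2 := by ring
    _ ≤ _ := by
      gcongr
      nlinarith [Real.sq_sqrt hu.le, sq_nonneg (√u - 1)]

lemma hasLaw_joint {Ω : Type*} [MeasurableSpace Ω] {P : Measure Ω} [IsProbabilityMeasure P]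
    {X Z G : Ω → ℝ} (hindep : iIndepFun ![X, Z, G] P) (hX : HasLaw X μ P)
    (hZ : HasLaw Z (gaussianReal 0 1) P) (hG : HasLaw G (gammaLaw (α - 1 / 2) lam) P) :
    HasLaw (fun w => (X w, Z w, G w)) (jointLaw α lam μ) P := by
  have hm : ∀ i, AEMeasurable (![X, Z, G] i) P := by
    intro i
    fin_cases i
    exacts [hX.aemeasurable, hZ.aemeasurable, hG.aemeasurable]
  have h1 : IndepFun (fun w => (Z w, G w)) X P :=
    hindep.indepFun_prodMk₀ hm 1 2 0 (by decide) (by decide)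
  have h2 : IndepFun Z G P := hindep.indepFun (show (1 : Fin 3) ≠ 2 by decide)
  have hZG := hZ.aemeasurable.prodMk hG.aemeasurable
  refine ⟨hX.aemeasurable.prodMk hZG, ?_⟩
  rw [(indepFun_iff_map_prod_eq_prod_map_map hX.aemeasurable hZG).1 h1.symm,
    (indepFun_iff_map_prod_eq_prod_map_map hZ.aemeasurable hG.aemeasurable).1 h2,
    hX.map_eq, hZ.map_eq, hG.map_eq, jointLaw]

/-- The prefactor of the theorem is the inverse of the constant `2 s / τ` produced by the truncated
formula. -/
lemma stein_constant (hlam : 0 < lam) (hτ0 : 0 < τ) (hτ1 : τ < 1) :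
    √(lam / 2) * (τ / √(1 - τ)) * (2 * √((1 - τ) / (2 * lam)) / τ) = 1 := by
  have h1τ : 0 < 1 - τ := sub_pos.2 hτ1
  have h1 : √((1 - τ) / (2 * lam)) = √(1 - τ) / √(2 * lam) := Real.sqrt_div h1τ.le _
  have h2 : √(lam / 2) = √(2 * lam) / 2 := by
    rw [show lam / 2 = 2 * lam / 2 ^ 2 by ring, Real.sqrt_div (by positivity),
      Real.sqrt_sq (by norm_num)]
  have := Real.sqrt_pos.2 h1τ
  have := Real.sqrt_pos.2 (show 0 < 2 * lam by positivity)
  rw [h1, h2]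
  field_simp

end

end LaguerreStein

/-! ### Assembly -/

open LaguerreStein
theorem mainTheorem8
    {Ω : Type*} [MeasurableSpace Ω] (P : Measure Ω) [IsProbabilityMeasure P]
    (α lam τ : ℝ) (hα : 1 / 2 ≤ α) (hlam : 0 < lam) (hτ0 : 0 < τ) (hτ1 : τ < 1)
    -- independent `X`, `Z`, `G`; `X` has density `f` on `(0, ∞)`
    (X Z G : Ω → ℝ) (hindep : iIndepFun ![X, Z, G] P)
    (f : ℝ → ℝ) (hf : Measurable f) (hf0 : ∀ x, 0 < x → 0 ≤ f x)
    (hX : HasLaw X ((volume.restrict (Ioi 0)).withDensity fun x => ENNReal.ofReal (f x)) P)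
    (hZ : HasLaw Z (gaussianReal 0 1) P)
    (hG : HasLaw G (gammaLaw (α - 1 / 2) lam) P)
    -- the Stein kernel of `X`
    (T : ℝ → ℝ) (hT : IsSteinKernel α lam (P.map X) T) :
    -- `X_τ`, as represented on `Ω`, has the law of the smart path
    HasLaw (fun w => pathPoint lam τ (X w) (Z w) (G w)) (smartPathLaw α lam τ (P.map X)) P ∧
    -- the ratio has modulus at most one
    (∀ᵐ w ∂P, |ratioV lam τ (X w) (Z w) (G w)| ≤ 1) ∧
    -- the Fisher information of `X_τ` is finite
    fisherInfo α lam (smartPathLaw α lam τ (P.map X)) ≠ ⊤ ∧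
    -- the right-hand expectation exists as soon as `E[√X |T(X)|]` is finite
    (Integrable (fun w => Real.sqrt (X w) * T (X w)) P →
      Integrable (fun w => steinIntegrand α lam τ f T (X w) (Z w) (G w)) P) ∧
    -- the representation formula holds whenever the right-hand expectation exists
    (Integrable (fun w => steinIntegrand α lam τ f T (X w) (Z w) (G w)) P →
      (fisherInfo α lam (smartPathLaw α lam τ (P.map X))).toReal =
        Real.sqrt (lam / 2) * (τ / Real.sqrt (1 - τ)) *
          ∫ w, steinIntegrand α lam τ f T (X w) (Z w) (G w) ∂P) := by
  set μ := P.map X with hμ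
  have hμf : μ = (volume.restrict (Ioi 0)).withDensity fun x => ENNReal.ofReal (f x) := hX.map_eq
  have hX' : HasLaw X μ P := ⟨hX.aemeasurable, rfl⟩
  have : IsProbabilityMeasure μ := Measure.isProbabilityMeasure_map hX.aemeasurable
  have hpos : ∀ᵐ x ∂μ, 0 < x := by
    rw [hμf]
    exact (withDensity_absolutelyContinuous _ _).ae_le (ae_restrict_mem measurableSet_Ioi)
  obtain ⟨r, hr⟩ : ∃ r, r = lam / (1 - τ) := ⟨_, rfl⟩
  have h1τ : 0 < 1 - τ := sub_pos.2 hτ1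
  have hr0 : 0 < r := hr ▸ by positivity
  have hlr : lam = r * (1 - τ) := by rw [hr]; field_simp
  have hid := integrable_id_of_stein hlam hT hpos
  have hTi := hT.integrable
  have hJ := hasLaw_joint hindep hX' hZ hG
  have hsm := smartPathLaw_eq hα hlam hτ0 hτ1 hr hpos
  have hmp := map_pathPoint hα hlam hτ0 hτ1 hr hpos
  set ν := (gammaMeasure α r).withDensity fun u => ENNReal.ofReal (relDensity α r τ μ u) with hν
  rw [hsm]
  have hSm := measurable_pathPoint lam τ
  have hνpos : ∀ᵐ u ∂ν, 0 < u := relDensity_measure_ae_pos hα hr0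
  have hS : HasLaw (fun p : ℝ × ℝ × ℝ => pathPoint lam τ p.1 p.2.1 p.2.2) ν (jointLaw α lam μ) :=
    ⟨hSm.aemeasurable, hmp⟩
  have hSΩ : HasLaw (fun w => pathPoint lam τ (X w) (Z w) (G w)) ν P := hS.fun_comp hJ
  have hνprob : IsProbabilityMeasure ν := hSΩ.isProbabilityMeasure_iff.1 ‹_›
  have hSpos : ∀ᵐ p ∂jointLaw α lam μ, 0 < pathPoint lam τ p.1 p.2.1 p.2.2 :=
    (hS.ae_iff (measurableSet_setOfPred.1 measurableSet_Ioi)).2 hνpos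
  have hfi : fisherInfo α lam ν = ∫⁻ u, ENNReal.ofReal (relScore α r τ μ u ^ 2) ∂ν :=
    fisherInfo_eq hα hr0 hτ0 hlr hpos hν
  have hνid : Integrable (fun u => u) ν := by
    have h := integrable_pathPoint hα hlam hτ0 hτ1 hpos hid
    rw [← hS.map_eq]
    exact (integrable_map_measure (f := fun p : ℝ × ℝ × ℝ => pathPoint lam τ p.1 p.2.1 p.2.2)
      (g := fun u => u) measurable_id.aestronglyMeasurable hSm.aemeasurable).2 h
  have hfin := lintegral_relScore_sq_ne_top hα hr0 hτ0 hpos hνpos hνid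
  have hFm := aestronglyMeasurable_relIntegrand (α := α) (lam := lam) hα hlam r τ
    hTi.aestronglyMeasurable
  have hFm' : AEStronglyMeasurable (relIntegrand α lam r τ μ T)
      (P.map fun w => (X w, Z w, G w)) := hJ.map_eq ▸ hFm
  -- The identification of `∂^σ v_τ` with the score holds on `(0, ∞)`, where `X_τ` lies almost
  -- surely.
  have hEq : ∀ᵐ w ∂P, steinIntegrand α lam τ f T (X w) (Z w) (G w) =
      relIntegrand α lam r τ μ T (X w, Z w, G w) := by
    filter_upwards [(hSΩ.ae_iff (measurableSet_setOfPred.1 measurableSet_Ioi)).2 hνpos] with w hw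
    rw [steinIntegrand, relIntegrand, dSigma_logRatio hα hlam hτ0 hτ1 hr hf hf0 hpos hμf hw]
  have hIff : Integrable (fun w => steinIntegrand α lam τ f T (X w) (Z w) (G w)) P ↔
      Integrable (relIntegrand α lam r τ μ T) (jointLaw α lam μ) := by
    rw [integrable_congr hEq, ← hJ.map_eq, integrable_map_measure hFm' hJ.aemeasurable]
    rfl
  refine ⟨hSΩ, ?_, hfi ▸ hfin, fun h => ?_, fun h => ?_⟩
  · have h0 : ∀ᵐ w ∂P, 0 ≤ G w :=
      (hG.ae_iff (measurableSet_setOfPred.1 measurableSet_Ici)).2 (gammaLaw_ae_nonneg _ _)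
    filter_upwards [h0] with w hw using abs_ratioV_le_one hτ1 hw _ _
  · rw [hIff]
    refine integrable_relIntegrand hα hlam hr0 hτ0 hτ1 hpos hid hTi ?_
    have hm : AEStronglyMeasurable (fun x => √x * T x) μ :=
      (by fun_prop : AEStronglyMeasurable (fun x : ℝ => √x) μ).mul hTi.aestronglyMeasurable
    exact (integrable_map_measure hm hX.aemeasurable).2 h
  · rw [hIff] at h
    have hsq : Integrable (fun u => relScore α r τ μ u ^ 2) ν := by
      refine ⟨((measurable_relScore hα r τ).pow_const 2).aestronglyMeasurable, ?_⟩
      rw [hasFiniteIntegral_iff_ofReal (ae_of_all _ fun u => sq_nonneg _)]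
      exact hfin.lt_top
    have hJr : (fisherInfo α lam ν).toReal = ∫ u, relScore α r τ μ u ^ 2 ∂ν := by
      rw [hfi, integral_eq_lintegral_of_nonneg_ae (ae_of_all _ fun u => sq_nonneg _)
        hsq.aestronglyMeasurable]
    have hint : ∫ w, steinIntegrand α lam τ f T (X w) (Z w) (G w) ∂P =
        ∫ p, relIntegrand α lam r τ μ T p ∂jointLaw α lam μ := by
      rw [integral_congr_ae hEq, ← hJ.map_eq, integral_map hJ.aemeasurable hFm']
    -- The left side of the truncated formula converges by the assumed integrability, the right side
    -- by finiteness of the Fisher information; the two limits give the full formula.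
    have hlim1 := tendsto_integral_mul_indicator h hSm.aemeasurable hSpos
    have hlim2 := (tendsto_integral_mul_indicator hsq aemeasurable_id hνpos).const_mul
      (2 * √((1 - τ) / (2 * lam)) / τ)
    have hlim : ∫ p, relIntegrand α lam r τ μ T p ∂jointLaw α lam μ =
        2 * √((1 - τ) / (2 * lam)) / τ * ∫ u, relScore α r τ μ u ^ 2 ∂ν :=
      tendsto_nhds_unique hlim1 (hlim2.congr fun n =>
        (integral_relIntegrand_indicator hα hlam hτ0 hτ1 hr hT hpos
          (show (0 : ℝ) < n + 1 by positivity)).symm)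
    rw [hJr, hint, hlim, ← mul_assoc, stein_constant hlam hτ0 hτ1, one_mul]
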